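/- Let $(X_i,Y_{i+},Y_{i-})$ be IID triples (assignment variable and the two potential outcomes), let $t\in\mathbb{R}$, let $\mu_\pm(x)=\mathbb{E}(Y_\pm\mid X=x)$ and $\sigma_\pm^2(x)=\mathrm{Var}(Y_\pm\mid X=x)$, and let $K$ be a kernel. Assume: (i) the triples are IID; (ii) $X$ has a density $f$ that is continuously differentiable at $t$, with $f(t)>0$; (iii) $\mu_\pm$ have three continuous derivatives in an open neighborhood of $t$; (iv) $K$ is nonnegative, symmetric, bounded, supported on $[-1,1]$, continuous on $[-1,1]$ and strictly positive somewhere; (v) $\sigma_\pm^2$ are bounded in a neighborhood of $t$, and continuous and strictly positive at $t$; (vi) $\mu_+''(t)\neq\mu_-''(t)$. In a regression discontinuity design (RDD), $Z_i=1$ if $X_i>t$ and $Z_i=-1$ otherwise. In a 3-level tie-breaker design (TBD) with fixed $\Delta>0$, the treatments $Z_i\in\{-1,1\}$ are assigned independently across subjects, with $\Pr(Z_i=1\mid X_i,Y_{i+},Y_{i-})$ equal to $0$ if $X_i<t-\Delta$, to $\tfrac12$ if $|X_i-t|\le\Delta$, and to $1$ if $X_i>t+\Delta$. In each design $Y_i=Y_{i+}$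 is observed if $Z_i=1$ and $Y_i=Y_{i-}$ if $Z_i=-1$, and with a bandwidth $h$ the effect $\tau=\mu_+(t)-\mu_-(t)$ is estimated by $\hat\tau_h=2\hat\beta_3+2\hat\beta_4t$, where $\hat\beta\in\mathbb{R}^4$ minimizes $\sum_{i=1}^N K\big(\tfrac{X_i-t}{h}\big)\big(Y_i-(\beta_1+\beta_2X_i+\beta_3Z_i+\beta_4X_iZ_i)\big)^2$. Let $\mathrm{MSE}(h,N)=\mathbb{E}\big[(\hat\tau_h-\tau)^2\,\big|\,(X_i,Z_i)_{i\le N}\big]$, computed for fixed $h$ from the conditional law of the responses; $\mathrm{MSE}(\hat h,N)$ denotes the substitution of a random $\hat h$ for $h$. Write $\mathrm{MSE}_{\mathrm{RDD}}$ and $\mathrm{MSE}_{\mathrm{TBD}}$ for the two designs. Let $\nu_j=\int_{-\infty}^\infty u^jK(u)\,du$, $\pi_j=\int_{-\infty}^\infty u^jK^2(u)\,du$, $\tilde\nu_j=\int_0^\infty u^jK(u)\,du$, $\tilde\pi_j=\int_0^\infty u^jK^2(u)\,du$, and $$C_1=\frac14\Big(\frac{\nu_2^2-\nu_1\nu_3}{\nu_0\nu_2-\nu_1^2}\Big)^2,\quad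 C_2=\frac{2\nu_2^2\pi_0-4\nu_1\nu_2\pi_1+2\nu_1^2\pi_2}{(\nu_2\nu_0-\nu_1^2)^2},\quad \tilde C_1=\frac14\Big(\frac{\tilde\nu_2^2-\tilde\nu_1\tilde\nu_3}{\tilde\nu_0\tilde\nu_2-\tilde\nu_1^2}\Big)^2,\quad \tilde C_2=\frac{\tilde\nu_2^2\tilde\pi_0-2\tilde\nu_1\tilde\nu_2\tilde\pi_1+\tilde\nu_1^2\tilde\pi_2}{(\tilde\nu_2\tilde\nu_0-\tilde\nu_1^2)^2}.$$ Let $\gamma=\Big(\frac{\sigma_+^2(t)+\sigma_-^2(t)}{f(t)(\mu_+''(t)-\mu_-''(t))^2}\Big)^{1/5}$, let $\hat\gamma_{\mathrm{RDD}}(N)$ and $\hat\gamma_{\mathrm{TBD}}(N)$ be any estimators that converge in probability to $\gamma$ as the sample size $N\to\infty$, and let $$\hat h_{\mathrm{RDD}}(N)=\Big(\frac{\tilde C_2}{4\tilde C_1}\Big)^{1/5}\hat\gamma_{\mathrm{RDD}}(N)\,N^{-1/5},\qquad \hat h_{\mathrm{TBD}}(N)=\Big(\frac{C_2}{4C_1}\Big)^{1/5}\hat\gamma_{\mathrm{TBD}}(N)\,N^{-1/5}.$$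 **Theorem 1.** Let $\theta>0$ and $\Delta>0$ be fixed, and let $M_N$ be integers with $M_N/N\to\theta$ (for instance $M_N=\lfloor\theta N\rfloor$). Under (i)–(vi), for an RDD with $N$ subjects and a TBD with $M_N$ subjects (the two samples may be dependent in any way), as $N\to\infty$, $$\frac{\mathrm{MSE}_{\mathrm{RDD}}\big(\hat h_{\mathrm{RDD}}(N),N\big)}{\mathrm{MSE}_{\mathrm{TBD}}\big(\hat h_{\mathrm{TBD}}(M_N),M_N\big)}\ \xrightarrow{\ p\ }\ \theta^{4/5}\Big(\frac{\tilde C_1\tilde C_2^4}{C_1C_2^4}\Big)^{1/5}.$$ The limit equals $1$ if and only if $\theta=\theta_*:=\dfrac{C_1^{1/4}C_2}{\tilde C_1^{1/4}\tilde C_2}$. The triangular kernel $K(u)=(1-|u|)_+$ satisfies (iv), and for it $\dfrac{\tilde C_1\tilde C_2^4}{C_1C_2^4}=60.466176$, so that the limit for $\theta=1$ is $60.466176^{1/5}\approx2.27$ and $\theta_*\approx0.359\approx0.36$ (rounded). -/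

import Mathlib

open MeasureTheory ProbabilityTheory Filter Topology

noncomputable section

/-! ### Kernels and kernel constants -/

/-- `ν j = ∫ u ^ j K(u) du` over the whole line. -/
def kerMoment (K : ℝ → ℝ) (j : ℕ) : ℝ := ∫ u, u ^ j * K u

/-- `π j = ∫ u ^ j K(u) ^ 2 du` over the whole line. -/
def kerSqMoment (K : ℝ → ℝ) (j : ℕ) : ℝ := ∫ u, u ^ j * K u ^ 2

/-- The one-sided moment `∫ u ^ j K(u) du` over `(0, ∞)`. -/
def kerHalfMoment (K : ℝ → ℝ) (j : ℕ) : ℝ := ∫ u in Set.Ioi (0 : ℝ), u ^ j * K u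

/-- The one-sided moment `∫ u ^ j K(u) ^ 2 du` over `(0, ∞)`. -/
def kerHalfSqMoment (K : ℝ → ℝ) (j : ℕ) : ℝ := ∫ u in Set.Ioi (0 : ℝ), u ^ j * K u ^ 2

/-- `C₁`, the squared-bias constant of the tie-breaker design. -/
def tbdC1 (K : ℝ → ℝ) : ℝ :=
  1 / 4 * ((kerMoment K 2 ^ 2 - kerMoment K 1 * kerMoment K 3) /
    (kerMoment K 0 * kerMoment K 2 - kerMoment K 1 ^ 2)) ^ 2

/-- `C₂`, the variance constant of the tie-breaker design. -/
def tbdC2 (K : ℝ → ℝ) : ℝ :=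
  (2 * kerMoment K 2 ^ 2 * kerSqMoment K 0
      - 4 * kerMoment K 1 * kerMoment K 2 * kerSqMoment K 1
      + 2 * kerMoment K 1 ^ 2 * kerSqMoment K 2) /
    (kerMoment K 2 * kerMoment K 0 - kerMoment K 1 ^ 2) ^ 2

/-- `C̃₁`, the squared-bias constant of the regression discontinuity design. -/
def rddC1 (K : ℝ → ℝ) : ℝ :=
  1 / 4 * ((kerHalfMoment K 2 ^ 2 - kerHalfMoment K 1 * kerHalfMoment K 3) /
    (kerHalfMoment K 0 * kerHalfMoment K 2 - kerHalfMoment K 1 ^ 2)) ^ 2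

/-- `C̃₂`, the variance constant of the regression discontinuity design. -/
def rddC2 (K : ℝ → ℝ) : ℝ :=
  (kerHalfMoment K 2 ^ 2 * kerHalfSqMoment K 0
      - 2 * kerHalfMoment K 1 * kerHalfMoment K 2 * kerHalfSqMoment K 1
      + kerHalfMoment K 1 ^ 2 * kerHalfSqMoment K 2) /
    (kerHalfMoment K 2 * kerHalfMoment K 0 - kerHalfMoment K 1 ^ 2) ^ 2

/-- `C̃₁ C̃₂⁴ / (C₁ C₂⁴)`. -/
def kerRatio (K : ℝ → ℝ) : ℝ :=
  (rddC1 K * rddC2 K ^ 4) / (tbdC1 K * tbdC2 K ^ 4)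

/-- `θ_* = C₁^(1/4) C₂ / (C̃₁^(1/4) C̃₂)`. -/
def thetaStar (K : ℝ → ℝ) : ℝ :=
  (tbdC1 K ^ (1 / 4 : ℝ) * tbdC2 K) / (rddC1 K ^ (1 / 4 : ℝ) * rddC2 K)

/-- The triangular kernel `(1 - |u|)₊`. -/
def triangularKernel (u : ℝ) : ℝ := max 0 (1 - |u|)

/-- Admissible kernels: condition (iv). -/
structure IsAdmissibleKernel (K : ℝ → ℝ) : Prop where
  nonneg : ∀ u, 0 ≤ K u
  symm : ∀ u, K (-u) = K u
  bdd : ∃ B, ∀ u, K u ≤ B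
  supp : ∀ u, 1 < |u| → K u = 0
  cont : ContinuousOn K (Set.Icc (-1) 1)
  pos : ∃ u, 0 < K u

/-! ### The population

`D` is the law of one triple `(X, Y₊, Y₋)`. -/

/-- `μ` and `v` are the conditional mean and the conditional variance functions of the random
variable `Y` given `X`, on the probability space `(S, D)`: for almost every value `x` of `X`, the
conditional law of `Y` given `X = x` has a finite second moment, mean `μ x` and variance `v x`. -/
def HasCondMeanVar {S : Type*} [MeasurableSpace S] (D : Measure S) [IsFiniteMeasure D]
    (X Y : S → ℝ) (μ v : ℝ → ℝ) : Prop :=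
  ∀ᵐ x ∂(D.map X), MemLp id 2 (condDistrib Y X D x) ∧
    ∫ y, y ∂(condDistrib Y X D x) = μ x ∧ Var[id; condDistrib Y X D x] = v x

/-- Conditions (ii), (iii), (v), (vi) on the law `D` of `(X, Y₊, Y₋)` at the threshold `t`, with
`f` the density of `X`, `μp`, `μm` the conditional means and `vp`, `vm` the conditional variances
of `Y₊`, `Y₋` given `X`. -/
structure RegularAt (D : Measure (ℝ × ℝ × ℝ)) [IsProbabilityMeasure D] (t : ℝ)
    (f μp μm vp vm : ℝ → ℝ) : Prop where
  density_measurable : Measurable f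
  density_nonneg : ∀ x, 0 ≤ f x
  density : D.map (fun w => w.1) = volume.withDensity (fun x => ENNReal.ofReal (f x))
  density_diff : ∀ᶠ x in 𝓝 t, DifferentiableAt ℝ f x
  density_deriv_cont : ContinuousAt (deriv f) t
  density_pos : 0 < f t
  cond_p : HasCondMeanVar D (fun w => w.1) (fun w => w.2.1) μp vp
  cond_m : HasCondMeanVar D (fun w => w.1) (fun w => w.2.2) μm vm
  mean_p : ContDiffAt ℝ 3 μp t
  mean_m : ContDiffAt ℝ 3 μm t
  var_p_bdd : ∃ B, ∀ᶠ x in 𝓝 t, vp x ≤ B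
  var_m_bdd : ∃ B, ∀ᶠ x in 𝓝 t, vm x ≤ B
  var_p_cont : ContinuousAt vp t
  var_m_cont : ContinuousAt vm t
  var_p_pos : 0 < vp t
  var_m_pos : 0 < vm t
  curvature_ne : iteratedDeriv 2 μp t ≠ iteratedDeriv 2 μm t

/-- `γ = ((σ₊²(t) + σ₋²(t)) / (f(t) (μ₊''(t) - μ₋''(t))²))^(1/5)`. -/
def gammaConst (t : ℝ) (f μp μm vp vm : ℝ → ℝ) : ℝ :=
  ((vp t + vm t) / (f t * (iteratedDeriv 2 μp t - iteratedDeriv 2 μm t) ^ 2)) ^ (1 / 5 : ℝ)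

/-! ### The two designs -/

section Designs

variable {Ω : Type*} [MeasurableSpace Ω]

/-- The triples `W i = (X i, Y₊ i, Y₋ i)` are IID with law `D`: condition (i). -/
structure IsIIDSample (P : Measure Ω) (D : Measure (ℝ × ℝ × ℝ)) (W : ℕ → Ω → ℝ × ℝ × ℝ) :
    Prop where
  meas : ∀ i, Measurable (W i)
  law : ∀ i, P.map (W i) = D
  indep : iIndepFun W P

/-- Treatment in the regression discontinuity design: `1` above the threshold, `-1` otherwise. -/
def rddTreatment (t x : ℝ) : ℝ := if t < x then 1 else -1

/-- Treatment probability in the three-level tie-breaker design. -/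
def tbdProb (t Δ x : ℝ) : ℝ := if x < t - Δ then 0 else if x ≤ t + Δ then 1 / 2 else 1

/-- The treatments `Z i ∈ {-1, 1}` follow the three-level tie-breaker design for the IID subjects
`W i`: subjects are treated independently of one another, and a subject with assignment variable
`X i` is treated with probability `tbdProb t Δ (X i)`, whatever its potential outcomes are. -/
structure IsTBDSample (P : Measure Ω) (D : Measure (ℝ × ℝ × ℝ)) (t Δ : ℝ)
    (W : ℕ → Ω → ℝ × ℝ × ℝ) (Z : ℕ → Ω → ℝ) : Prop where
  iid : IsIIDSample P D W
  meas : ∀ i, Measurable (Z i)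
  values : ∀ i ω, Z i ω = 1 ∨ Z i ω = -1
  indep : iIndepFun (fun i ω => (W i ω, Z i ω)) P
  prob : ∀ i, P⟦Z i ⁻¹' {1} | MeasurableSpace.comap (W i) inferInstance⟧
    =ᵐ[P] fun ω => tbdProb t Δ (W i ω).1

/-! ### Local linear regression and its mean squared error -/

/-- The kernel weighted least squares criterion. -/
def wlsCriterion (K : ℝ → ℝ) (t h : ℝ) {N : ℕ} (x z y : Fin N → ℝ) (β : Fin 4 → ℝ) : ℝ :=
  ∑ i, K ((x i - t) / h) * (y i - (β 0 + β 1 * x i + β 2 * z i + β 3 * x i * z i)) ^ 2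

/-- The type of rules that compute a coefficient vector from the bandwidth `h` and the data
`x`, `z`, `y` of `N` subjects. -/
abbrev FitRule : Type :=
  (N : ℕ) → (h : ℝ) → (x z y : Fin N → ℝ) → (Fin 4 → ℝ)

/-- `βhat` always returns a minimizer of the criterion. (A minimizer always exists; it is unique
unless the weighted design is degenerate, in which case any of them may be returned.) -/
def IsLocalLinearFit (K : ℝ → ℝ) (t : ℝ) (βhat : FitRule) : Prop :=
  ∀ (N : ℕ) (h : ℝ) (x z y : Fin N → ℝ) (β : Fin 4 → ℝ),
    wlsCriterion K t h x z y (βhat N h x z y) ≤ wlsCriterion K t h x z y β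

/-- The estimator `2 β₃ + 2 β₄ t` of the treatment effect at the threshold. -/
def tauHat (βhat : FitRule) (t : ℝ) {N : ℕ} (h : ℝ) (x z y : Fin N → ℝ) : ℝ :=
  2 * βhat N h x z y 2 + 2 * βhat N h x z y 3 * t

/-- The assignment variables and treatments of the first `N` subjects. -/
def designOf (W : ℕ → Ω → ℝ × ℝ × ℝ) (Z : ℕ → Ω → ℝ) (N : ℕ) (ω : Ω) :
    (Fin N → ℝ) × (Fin N → ℝ) :=
  (fun i => (W i ω).1, fun i => Z i ω)

/-- The observed responses of the first `N` subjects: `Y₊` if treated, `Y₋` if not. -/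
def responseOf (W : ℕ → Ω → ℝ × ℝ × ℝ) (Z : ℕ → Ω → ℝ) (N : ℕ) (ω : Ω) : Fin N → ℝ :=
  fun i => if Z i ω = 1 then (W i ω).2.1 else (W i ω).2.2

/-- `MSE(h, N) = E[(τ̂_h - τ)² | design]`, the mean squared error of the estimator with bandwidth
`h` from `N` subjects, conditional on their assignment variables and treatments. It is a random
variable for each `h`; computing it from the conditional law of the responses given the design
gives it for all `h` simultaneously, so that a random bandwidth can be substituted for `h`. -/
def condMSE (P : Measure Ω) [IsFiniteMeasure P] (βhat : FitRule) (t τ : ℝ)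
    (W : ℕ → Ω → ℝ × ℝ × ℝ) (Z : ℕ → Ω → ℝ) (h : ℝ) (N : ℕ) (ω : Ω) : ℝ :=
  ∫ y, (tauHat βhat t h (designOf W Z N ω).1 (designOf W Z N ω).2 y - τ) ^ 2
    ∂(condDistrib (responseOf W Z N) (designOf W Z N) P (designOf W Z N ω))

end Designs

/-- Estimated optimal bandwidth of the regression discontinuity design with `N` subjects, given
the estimate `g` of `γ`. -/
def rddBandwidth (K : ℝ → ℝ) (g : ℝ) (N : ℕ) : ℝ :=
  (rddC2 K / (4 * rddC1 K)) ^ (1 / 5 : ℝ) * g * (N : ℝ) ^ (-(1 / 5) : ℝ)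

/-- Estimated optimal bandwidth of the tie-breaker design with `N` subjects, given the estimate
`g` of `γ`. -/
def tbdBandwidth (K : ℝ → ℝ) (g : ℝ) (N : ℕ) : ℝ :=
  (tbdC2 K / (4 * tbdC1 K)) ^ (1 / 5 : ℝ) * g * (N : ℝ) ^ (-(1 / 5) : ℝ)

end

/-! Conditionally on the design the estimator is linear in the responses, so its mean squared error
has a closed form. Since `Z = ±1`, the four-parameter regression splits into one local linear fit
per arm, and the estimator is the difference of the two intercepts at `t`
(`tauHat_eq_sum_contrastWeight`). Given the design the responses are independent and follow the
conditional laws of the potential outcomes given `X`. The error is therefore a squared bias plus a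
variance (`IsDesign.condMSE_ae_eq`), almost surely for all bandwidths at once, which makes the
substitution of a random bandwidth legitimate.

The fit weights are rational functions of the kernel sums over an arm. A Chebyshev argument gives
the limits of these sums for a deterministic bandwidth (`IsDesign.tendsto_armSum`), and a bound on
the effect of small dilations carries them over to a random bandwidth with ratio tending to one
(`IsDesign.tendsto_armSum_random`). The designs enter only through the local shape of the arm
probabilities at `t`: half-line indicators for the RDD, the constant `1/2` for the TBD. This
produces one-sided moments in the first case and two-sided ones in the second.

A local linear fit reproduces affine functions, so the bias is of order `h ^ 2` with factor `μ₊'' -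
μ₋''`, and the variance is of order `1 / (N h)`. With `h = c N ^ (-1/5)` both contribute to the
limit of `N ^ (4/5) * MSE` (`IsDesign.tendsto_condMSE`). At the optimal `c` the variance is four
times the squared bias, and the limit is proportional to `(C₁ C₂ ^ 4) ^ (1/5)` with the same
population factor in both designs (`RegularAt.optimal_mse`). In the ratio that factor cancels, and
the two sample sizes contribute `θ ^ (4/5)`. Each error converges to a positive constant in
probability, so the joint law of the two samples plays no role. -/

open scoped ENNReal

/-! ### Convergence in probability as convergence along a filter -/

section ProbFilter

variable {Ω : Type*} [MeasurableSpace Ω]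

/-- The filter on `ℕ × Ω` whose sets are the sequences of events with probability tending to one.
Convergence in probability to a constant is convergence along this filter. -/
def probFilter (P : Measure Ω) : Filter (ℕ × Ω) where
  sets := {A | Tendsto (fun N => P {ω | (N, ω) ∉ A}) atTop (𝓝 0)}
  univ_sets := by simp
  sets_of_superset {A B} hA hAB :=
    tendsto_of_tendsto_of_tendsto_of_le_of_le tendsto_const_nhds hA (fun _ => zero_le)
      (fun N => measure_mono fun ω hω h => hω (hAB h))
  inter_sets {A B} hA hB := by
    have hA' : Tendsto (fun N => P {ω | (N, ω) ∉ A}) atTop (𝓝 0) := hA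
    have hB' : Tendsto (fun N => P {ω | (N, ω) ∉ B}) atTop (𝓝 0) := hB
    have h := hA'.add hB'
    rw [add_zero] at h
    refine tendsto_of_tendsto_of_tendsto_of_le_of_le tendsto_const_nhds h (fun _ => zero_le)
      (fun N => ?_)
    refine (measure_mono fun ω hω => ?_).trans (measure_union_le _ _)
    by_contra hc
    simp only [Set.mem_union, Set.mem_ofPred_eq, not_or, not_not] at hc
    exact hω hc

lemma eventually_probFilter_iff {P : Measure Ω} {p : ℕ × Ω → Prop} :
    (∀ᶠ x in probFilter P, p x) ↔ Tendsto (fun N => P {ω | ¬ p (N, ω)}) atTop (𝓝 0) :=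
  Iff.rfl

/-- The bridge that lets the ordinary limit calculus of filters replace Slutsky-type arguments. -/
lemma tendstoInMeasure_const_iff {P : Measure Ω} {X : ℕ → Ω → ℝ} {c : ℝ} :
    TendstoInMeasure P X atTop (fun _ => c) ↔
      Tendsto (fun x : ℕ × Ω => X x.1 x.2) (probFilter P) (𝓝 c) := by
  rw [EMetric.tendsto_nhds]
  simp only [eventually_probFilter_iff, not_lt]
  rfl

lemma eventually_probFilter_of_ae {P : Measure Ω} {p : ℕ × Ω → Prop}
    (h : ∀ N, ∀ᵐ ω ∂P, p (N, ω)) : ∀ᶠ x in probFilter P, p x := by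
  rw [eventually_probFilter_iff]
  have : ∀ N, P {ω | ¬ p (N, ω)} = 0 := fun N => h N
  simp [this]

lemma tendsto_fst_probFilter (P : Measure Ω) : Tendsto Prod.fst (probFilter P) atTop := by
  intro s hs
  rw [mem_map]
  change Tendsto (fun N => P {ω | (N, ω) ∉ Prod.fst ⁻¹' s}) atTop (𝓝 0)
  refine tendsto_const_nhds.congr' ?_
  filter_upwards [hs] with N hN
  simp [hN]

/-- Used to read a limit in the sample size along the sizes `M N` of the second design. -/
lemma tendsto_map_probFilter (P : Measure Ω) {M : ℕ → ℕ} (hM : Tendsto M atTop atTop) :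
    Tendsto (fun x : ℕ × Ω => (M x.1, x.2)) (probFilter P) (probFilter P) := by
  intro s hs
  have hs' : Tendsto (fun N => P {ω | (N, ω) ∉ s}) atTop (𝓝 0) := hs
  exact hs'.comp hM

end ProbFilter

/-! ### Weighted local linear fits -/

section LocalLinear

variable {ι : Type*} [Fintype ι]

/-- The weighted power sum `∑ aᵢ uᵢ ^ j`. -/
def powerSum (a u : ι → ℝ) (j : ℕ) : ℝ := ∑ i, a i * u i ^ j

/-- The determinant of the normal equations of a weighted linear fit. -/
def fitDet (a u : ι → ℝ) : ℝ := powerSum a u 0 * powerSum a u 2 - powerSum a u 1 ^ 2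

/-- The weight of the response of subject `i` in the intercept of a weighted linear fit. -/
noncomputable def fitWeight (a u : ι → ℝ) (i : ι) : ℝ :=
  a i * (powerSum a u 2 - powerSum a u 1 * u i) / fitDet a u

lemma sum_fitWeight_mul (a u y : ι → ℝ) :
    ∑ i, fitWeight a u i * y i =
      (powerSum a u 2 * ∑ i, a i * y i - powerSum a u 1 * ∑ i, a i * u i * y i) / fitDet a u := by
  rw [Finset.mul_sum, Finset.mul_sum, ← Finset.sum_sub_distrib, Finset.sum_div]
  refine Finset.sum_congr rfl fun i _ => ?_
  rw [fitWeight]; ring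

lemma sum_fitWeight_mul_pow (a u : ι → ℝ) (j : ℕ) :
    ∑ i, fitWeight a u i * u i ^ j =
      (powerSum a u 2 * powerSum a u j - powerSum a u 1 * powerSum a u (j + 1)) / fitDet a u := by
  rw [sum_fitWeight_mul]
  simp only [powerSum, pow_succ' _ j, mul_assoc]

lemma sum_fitWeight {a u : ι → ℝ} (h : fitDet a u ≠ 0) : ∑ i, fitWeight a u i = 1 := by
  have := sum_fitWeight_mul_pow a u 0
  simp only [pow_zero, mul_one, zero_add] at this
  rw [this, div_eq_one_iff_eq h, fitDet]; ring

/-- Together with `sum_fitWeight`, this is exactness on affine functions: the bias of the intercept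
starts at second order. -/
lemma sum_fitWeight_mul_self (a u : ι → ℝ) : ∑ i, fitWeight a u i * u i = 0 := by
  have := sum_fitWeight_mul_pow a u 1
  simp only [pow_one] at this
  rw [this, mul_comm, sub_self, zero_div]

lemma sum_fitWeight_sq (a u : ι → ℝ) :
    ∑ i, fitWeight a u i ^ 2 =
      (powerSum a u 2 ^ 2 * powerSum (fun i => a i ^ 2) u 0
        - 2 * powerSum a u 1 * powerSum a u 2 * powerSum (fun i => a i ^ 2) u 1
        + powerSum a u 1 ^ 2 * powerSum (fun i => a i ^ 2) u 2) / fitDet a u ^ 2 := by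
  have h : ∀ j, powerSum (fun i => a i ^ 2) u j = ∑ i, a i ^ 2 * u i ^ j := fun _ => rfl
  rw [h, h, h, Finset.mul_sum, Finset.mul_sum, Finset.mul_sum, ← Finset.sum_sub_distrib,
    ← Finset.sum_add_distrib, Finset.sum_div]
  refine Finset.sum_congr rfl fun i _ => ?_
  rw [fitWeight]; ring

/-- The weights can be negative, so summing to one does not bound them; this `ℓ¹` bound is what
controls the Taylor remainder in the bias. -/
lemma sum_abs_fitWeight_le {a u : ι → ℝ} (ha : ∀ i, 0 ≤ a i) (hu : ∀ i, a i ≠ 0 → |u i| ≤ 1) :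
    ∑ i, |fitWeight a u i| ≤
      powerSum a u 0 * (|powerSum a u 2| + |powerSum a u 1|) / |fitDet a u| := by
  simp only [fitWeight, abs_div, abs_mul]
  rw [← Finset.sum_div]
  refine div_le_div_of_nonneg_right ?_ (abs_nonneg _)
  have h0 : powerSum a u 0 = ∑ i, a i := by simp [powerSum]
  rw [h0, Finset.sum_mul]
  refine Finset.sum_le_sum fun i _ => ?_
  rw [abs_of_nonneg (ha i)]
  by_cases h : a i = 0
  · simp [h]
  refine mul_le_mul_of_nonneg_left ((abs_sub _ _).trans ?_) (ha i)
  rw [abs_mul]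
  have := mul_le_mul_of_nonneg_left (hu i h) (abs_nonneg (powerSum a u 1))
  linarith

/-- The intercept is determined by the normal equations. -/
lemma eq_sum_fitWeight_of_normal_equations {a u y : ι → ℝ} (h : fitDet a u ≠ 0) {c d : ℝ}
    (h0 : ∑ i, a i * (y i - (c + d * u i)) = 0)
    (h1 : ∑ i, a i * u i * (y i - (c + d * u i)) = 0) :
    c = ∑ i, fitWeight a u i * y i := by
  have e0 : ∑ i, a i * (y i - (c + d * u i)) =
      ∑ i, a i * y i - (c * powerSum a u 0 + d * powerSum a u 1) := by
    simp only [powerSum, Finset.mul_sum, ← Finset.sum_add_distrib, ← Finset.sum_sub_distrib]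
    exact Finset.sum_congr rfl fun i _ => by ring
  have e1 : ∑ i, a i * u i * (y i - (c + d * u i)) =
      ∑ i, a i * u i * y i - (c * powerSum a u 1 + d * powerSum a u 2) := by
    simp only [powerSum, Finset.mul_sum, ← Finset.sum_add_distrib, ← Finset.sum_sub_distrib]
    exact Finset.sum_congr rfl fun i _ => by ring
  rw [sum_fitWeight_mul, eq_div_iff h, fitDet]
  rw [e0] at h0
  rw [e1] at h1
  -- Cramer's rule: this combination eliminates the slope `d`.
  linear_combination powerSum a u 1 * h1 - powerSum a u 2 * h0

end LocalLinear

/-! ### Splitting the interacted regression into one fit per arm -/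

/-- A minimizer of the criterion satisfies the normal equations. -/
lemma sum_residual_eq_zero_of_isMin {K : ℝ → ℝ} {t h : ℝ} {N : ℕ} {x z y : Fin N → ℝ}
    {β : Fin 4 → ℝ} (hβ : ∀ β', wlsCriterion K t h x z y β ≤ wlsCriterion K t h x z y β')
    (d : Fin 4 → ℝ) :
    ∑ i, K ((x i - t) / h) * (d 0 + d 1 * x i + d 2 * z i + d 3 * x i * z i) *
      (y i - (β 0 + β 1 * x i + β 2 * z i + β 3 * x i * z i)) = 0 := by
  set A := ∑ i, K ((x i - t) / h) * (d 0 + d 1 * x i + d 2 * z i + d 3 * x i * z i) *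
      (y i - (β 0 + β 1 * x i + β 2 * z i + β 3 * x i * z i)) with hA
  set B := ∑ i, K ((x i - t) / h) * (d 0 + d 1 * x i + d 2 * z i + d 3 * x i * z i) ^ 2 with hB
  -- Along the line `β + s d` the criterion is a quadratic in `s` that is smallest at `s = 0`.
  have key : ∀ s : ℝ, 0 ≤ s ^ 2 * B - 2 * s * A := by
    intro s
    have h1 := hβ (fun k => β k + s * d k)
    have h2 : wlsCriterion K t h x z y (fun k => β k + s * d k) =
        wlsCriterion K t h x z y β + (s ^ 2 * B - 2 * s * A) := by
      simp only [wlsCriterion, hA, hB, Finset.mul_sum, ← Finset.sum_add_distrib,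
        ← Finset.sum_sub_distrib]
      exact Finset.sum_congr rfl fun i _ => by ring
    linarith
  by_contra hne
  have hB1 : 0 < |B| + 1 := by positivity
  -- The vertex would be `A / B`; the denominator `|B| + 1` also covers `B = 0` and still makes the
  -- quadratic negative when `A ≠ 0`.
  have h1 := key (A / (|B| + 1))
  have h2 : (A / (|B| + 1)) ^ 2 * B - 2 * (A / (|B| + 1)) * A =
      A ^ 2 * (B - 2 * (|B| + 1)) / (|B| + 1) ^ 2 := by
    field_simp
  rw [h2] at h1
  have h3 : A ^ 2 * (B - 2 * (|B| + 1)) < 0 :=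
    mul_neg_of_pos_of_neg (by positivity) (by linarith [le_abs_self B, abs_nonneg B])
  have := div_neg_of_neg_of_pos h3 (pow_pos hB1 2)
  linarith

/-- The indicators of the two arms, as functions of the treatment. -/
noncomputable def armIndicator (b : Bool) (z : ℝ) : ℝ := if (z = 1 ↔ b = true) then 1 else 0

/-- The kernel weights in one arm of the design. -/
noncomputable def armWeight (K : ℝ → ℝ) (t h : ℝ) (b : Bool) {N : ℕ} (x z : Fin N → ℝ)
    (i : Fin N) : ℝ :=
  K ((x i - t) / h) * armIndicator b (z i)

/-- The weight of the response of subject `i` in the difference of the two local linear fits. -/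
noncomputable def contrastWeight (K : ℝ → ℝ) (t h : ℝ) {N : ℕ} (x z : Fin N → ℝ) (i : Fin N) : ℝ :=
  fitWeight (armWeight K t h true x z) (fun i => (x i - t) / h) i
    - fitWeight (armWeight K t h false x z) (fun i => (x i - t) / h) i

/-- The estimator is the difference of the local linear fits in the two arms. -/
theorem tauHat_eq_sum_contrastWeight {K : ℝ → ℝ} {t : ℝ} {βhat : FitRule}
    (hβ : IsLocalLinearFit K t βhat) {N : ℕ} {h : ℝ} (hh : h ≠ 0) {x z : Fin N → ℝ}
    (hz : ∀ i, z i = 1 ∨ z i = -1)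
    (hdet : ∀ b, fitDet (armWeight K t h b x z) (fun i => (x i - t) / h) ≠ 0) (y : Fin N → ℝ) :
    tauHat βhat t h x z y = ∑ i, contrastWeight K t h x z i * y i := by
  set β := βhat N h x z y with hβdef
  have hN : ∀ d0 d1 d2 d3 : ℝ, ∑ i, K ((x i - t) / h) *
      (d0 + d1 * x i + d2 * z i + d3 * x i * z i) *
      (y i - (β 0 + β 1 * x i + β 2 * z i + β 3 * x i * z i)) = 0 := fun d0 d1 d2 d3 => by
    simpa using sum_residual_eq_zero_of_isMin (hβ N h x z y) ![d0, d1, d2, d3]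
  -- For `z = ±1` the factor `(1 + s z) / 2` is the indicator of the arm `z = s`. On that arm the
  -- model is a line in `(x - t) / h`, and its intercept is the left-hand side.
  have arm : ∀ (b : Bool) (s : ℝ), s = (if b then 1 else -1) →
      β 0 + s * β 2 + (β 1 + s * β 3) * t = ∑ i, fitWeight (armWeight K t h b x z)
      (fun i => (x i - t) / h) i * y i := by
    intro b s hs
    have hs2 : s = 1 ∨ s = -1 := by cases b <;> simp [hs]
    have hi : ∀ i, armIndicator b (z i) = (1 + s * z i) / 2 := by
      intro i
      rcases hz i with hzi | hzi <;> cases b <;> simp [armIndicator, hzi, hs] <;> norm_num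
    have hzz : ∀ i, z i * z i = 1 := fun i => by rcases hz i with hzi | hzi <;> simp [hzi]
    have hss : s * s = 1 := by rcases hs2 with h | h <;> simp [h]
    have hr : ∀ i, (1 + s * z i) * (β 0 + β 1 * x i + β 2 * z i + β 3 * x i * z i) =
        (1 + s * z i) * (β 0 + s * β 2 + (β 1 + s * β 3) * t +
          h * (β 1 + s * β 3) * ((x i - t) / h)) := by
      intro i
      have : h * (β 1 + s * β 3) * ((x i - t) / h) = (β 1 + s * β 3) * (x i - t) := by
        field_simp
      rw [this]
      linear_combination s * (β 2 + β 3 * x i) * hzz i - z i * (β 2 + β 3 * x i) * hss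
    refine eq_sum_fitWeight_of_normal_equations (hdet b) (d := h * (β 1 + s * β 3)) ?_ ?_
    -- Test directions: here the regressor is the arm indicator itself, in the second case the
    -- indicator times `(x - t) / h`.
    · rw [← hN (1 / 2) 0 (s / 2) 0]
      refine Finset.sum_congr rfl fun i _ => ?_
      rw [armWeight, hi]
      linear_combination K ((x i - t) / h) / 2 * hr i
    · rw [← hN (-t / (2 * h)) (1 / (2 * h)) (s * (-t / (2 * h))) (s * (1 / (2 * h)))]
      refine Finset.sum_congr rfl fun i _ => ?_
      have : -t / (2 * h) + 1 / (2 * h) * x i + s * (-t / (2 * h)) * z i +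
          s * (1 / (2 * h)) * x i * z i = (x i - t) / h * ((1 + s * z i) / 2) := by
        field_simp; ring
      rw [armWeight, hi, this]
      linear_combination K ((x i - t) / h) / 2 * ((x i - t) / h) * hr i
  simp only [contrastWeight, sub_mul, Finset.sum_sub_distrib]
  rw [← arm true 1 rfl, ← arm false (-1) rfl, tauHat, ← hβdef]
  ring

/-! ### Windows: functions continuous on `[-1, 1]` and zero outside -/

/-- Functions that are continuous on `[-1, 1]` and vanish outside. -/
structure IsWindow (g : ℝ → ℝ) : Prop where
  supp : ∀ u, 1 < |u| → g u = 0
  cont : ContinuousOn g (Set.Icc (-1) 1)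

namespace IsWindow

variable {g : ℝ → ℝ}

lemma eq_indicator (hg : IsWindow g) : g = (Set.Icc (-1 : ℝ) 1).indicator g := by
  ext u
  by_cases hu : u ∈ Set.Icc (-1 : ℝ) 1
  · rw [Set.indicator_of_mem hu]
  · rw [Set.indicator_of_notMem hu]
    exact hg.supp u (not_le.1 fun h => hu (abs_le.1 h))

lemma measurable (hg : IsWindow g) : Measurable g := by
  have h := hg.cont.measurable_piecewise (g := fun _ => (0 : ℝ)) continuousOn_const
    measurableSet_Icc
  rw [hg.eq_indicator]
  classical
  convert h using 1
  ext u
  simp [Set.indicator, Set.piecewise]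

lemma bounded (hg : IsWindow g) : ∃ B, 0 ≤ B ∧ ∀ u, |g u| ≤ B := by
  obtain ⟨B, hB⟩ := isCompact_Icc.exists_bound_of_continuousOn hg.cont
  refine ⟨max B 0, le_max_right _ _, fun u => ?_⟩
  by_cases hu : u ∈ Set.Icc (-1 : ℝ) 1
  · exact (hB u hu).trans (le_max_left _ _)
  · rw [hg.supp u (not_le.1 fun h => hu (abs_le.1 h)), abs_zero]
    exact le_max_right _ _

lemma integrable (hg : IsWindow g) : Integrable g := by
  rw [hg.eq_indicator, integrable_indicator_iff measurableSet_Icc]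
  exact hg.cont.integrableOn_Icc

lemma mul_left (hg : IsWindow g) {p : ℝ → ℝ} (hp : Continuous p) :
    IsWindow (fun u => p u * g u) :=
  ⟨fun u hu => by rw [hg.supp u hu, mul_zero], hp.continuousOn.mul hg.cont⟩

lemma sq (hg : IsWindow g) : IsWindow (fun u => g u ^ 2) :=
  ⟨fun u hu => by rw [hg.supp u hu]; simp, hg.cont.pow 2⟩

lemma pow_mul (hg : IsWindow g) (j : ℕ) : IsWindow (fun u => u ^ j * g u) :=
  hg.mul_left (continuous_pow j)

/-- A quadratic form in `(c, d)`; its positivity encodes the strict Cauchy–Schwarz inequalities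
between consecutive half-line moments. -/
lemma integral_sq_mul (hg : IsWindow g) (j : ℕ) (c d : ℝ) :
    ∫ u in Set.Ioi (0 : ℝ), (u ^ j * (c + d * u) ^ 2) * g u =
      c ^ 2 * (∫ u in Set.Ioi (0 : ℝ), u ^ j * g u)
        + 2 * c * d * (∫ u in Set.Ioi (0 : ℝ), u ^ (j + 1) * g u)
        + d ^ 2 * (∫ u in Set.Ioi (0 : ℝ), u ^ (j + 2) * g u) := by
  have hi : ∀ k, Integrable (fun u => u ^ k * g u) (volume.restrict (Set.Ioi (0 : ℝ))) :=
    fun k => (hg.pow_mul k).integrable.integrableOn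
  rw [← integral_const_mul, ← integral_const_mul, ← integral_const_mul,
    ← integral_add ((hi _).const_mul _) ((hi _).const_mul _),
    ← integral_add (f := fun u => c ^ 2 * (u ^ j * g u) + 2 * c * d * (u ^ (j + 1) * g u))
      (((hi _).const_mul _).add ((hi _).const_mul _)) ((hi _).const_mul _)]
  refine integral_congr_ae (Eventually.of_forall fun u => ?_)
  simp only
  ring

/-- A nonzero affine function has at most one root, so the integrand is positive on `(a, b)` up to a
null set. -/
lemma integral_sq_mul_pos (hg : IsWindow g) (h0 : ∀ u, 0 ≤ g u) {a b : ℝ} (ha : 0 ≤ a)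
    (hab : a < b) (hpos : ∀ u ∈ Set.Ioo a b, 0 < g u) (j : ℕ) {c d : ℝ} (hcd : c ≠ 0 ∨ d ≠ 0) :
    0 < ∫ u in Set.Ioi (0 : ℝ), (u ^ j * (c + d * u) ^ 2) * g u := by
  have hwin : IsWindow (fun u => (u ^ j * (c + d * u) ^ 2) * g u) :=
    hg.mul_left (by fun_prop)
  rw [setIntegral_pos_iff_support_of_nonneg_ae]
  · have hsub : Set.Ioo a b \ {-c / d} ⊆
        Function.support (fun u => (u ^ j * (c + d * u) ^ 2) * g u) ∩ Set.Ioi (0 : ℝ) := by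
      intro u hu
      have hu0 : 0 < u := ha.trans_lt hu.1.1
      have hlin : c + d * u ≠ 0 := by
        intro h
        by_cases hd : d = 0
        · simp [hd] at h hcd
          exact hcd h
        · exact hu.2 (by rw [Set.mem_singleton_iff, eq_div_iff hd]; linarith)
      refine ⟨?_, hu0⟩
      rw [Function.mem_support]
      exact mul_ne_zero (mul_ne_zero (pow_ne_zero _ hu0.ne') (pow_ne_zero _ hlin))
        (hpos u hu.1).ne'
    refine lt_of_lt_of_le ?_ (measure_mono hsub)
    rw [measure_sdiff_null ((Set.finite_singleton _).measure_zero _), Real.volume_Ioo]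
    simpa using hab
  · refine (ae_restrict_iff' measurableSet_Ioi).2 (Eventually.of_forall fun u hu => ?_)
    have : (0 : ℝ) < u := hu
    simp only [Pi.zero_apply]
    have := h0 u
    positivity
  · exact hwin.integrable.integrableOn

end IsWindow

/-! ### Kernel constants -/

namespace IsAdmissibleKernel

variable {K : ℝ → ℝ}

lemma isWindow (hK : IsAdmissibleKernel K) : IsWindow K := ⟨hK.supp, hK.cont⟩

/-- Symmetry moves a point of positivity to `[0, 1]`, and continuity spreads it to an interval. -/
lemma exists_Ioo_pos (hK : IsAdmissibleKernel K) :
    ∃ a b : ℝ, 0 ≤ a ∧ a < b ∧ ∀ u ∈ Set.Ioo a b, 0 < K u := by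
  obtain ⟨u₀, hu₀⟩ := hK.pos
  have hv : 0 < K |u₀| := by
    rcases abs_choice u₀ with h | h <;> rw [h]
    · exact hu₀
    · rwa [hK.symm]
  set v := |u₀| with hvdef
  have hv0 : 0 ≤ v := abs_nonneg _
  have hv1 : v ≤ 1 := by
    by_contra h
    rw [hK.supp v (by rw [abs_of_nonneg hv0]; exact not_le.1 h)] at hv
    exact lt_irrefl _ hv
  have hc := hK.cont v ⟨by linarith, hv1⟩
  have hev := hc.eventually (lt_mem_nhds hv)
  rw [eventually_nhdsWithin_iff, Metric.eventually_nhds_iff] at hev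
  obtain ⟨ε, hε, hev⟩ := hev
  -- The truncation at `1` is needed because the kernel may jump there: continuity is only within
  -- `[-1, 1]`.
  refine ⟨max 0 (v - ε), min 1 (v + ε), le_max_left _ _, ?_, fun u hu => ?_⟩
  · refine max_lt (lt_min one_pos (by linarith)) (lt_min (by linarith) (by linarith))
  · have h1 := max_lt_iff.1 hu.1
    have h2 := lt_min_iff.1 hu.2
    refine hev ?_ ⟨by linarith [h1.1], h2.1.le⟩
    rw [Real.dist_eq, abs_lt]
    constructor <;> linarith [h1.2, h2.2]

lemma half_sq_pos (hK : IsAdmissibleKernel K) (j : ℕ) {c d : ℝ} (hcd : c ≠ 0 ∨ d ≠ 0) :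
    0 < c ^ 2 * kerHalfMoment K j + 2 * c * d * kerHalfMoment K (j + 1)
      + d ^ 2 * kerHalfMoment K (j + 2) := by
  obtain ⟨a, b, ha, hab, hp⟩ := hK.exists_Ioo_pos
  have := hK.isWindow.integral_sq_mul_pos hK.nonneg ha hab hp j hcd
  rwa [hK.isWindow.integral_sq_mul] at this

lemma half_sq_pos' (hK : IsAdmissibleKernel K) (j : ℕ) {c d : ℝ} (hcd : c ≠ 0 ∨ d ≠ 0) :
    0 < c ^ 2 * kerHalfSqMoment K j + 2 * c * d * kerHalfSqMoment K (j + 1)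
      + d ^ 2 * kerHalfSqMoment K (j + 2) := by
  obtain ⟨a, b, ha, hab, hp⟩ := hK.exists_Ioo_pos
  have := hK.isWindow.sq.integral_sq_mul_pos (fun u => sq_nonneg _) ha hab
    (fun u hu => pow_pos (hp u hu) 2) j hcd
  rwa [hK.isWindow.sq.integral_sq_mul] at this

lemma halfMoment_pos (hK : IsAdmissibleKernel K) (j : ℕ) : 0 < kerHalfMoment K j := by
  simpa using hK.half_sq_pos j (c := 1) (d := 0) (by simp)

lemma halfSqMoment_pos (hK : IsAdmissibleKernel K) (j : ℕ) : 0 < kerHalfSqMoment K j := by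
  simpa using hK.half_sq_pos' j (c := 1) (d := 0) (by simp)

/-- With `c = ν̃₁` and `d = -ν̃₀` the form of `half_sq_pos` equals `ν̃₀` times the determinant. -/
lemma half_det_pos (hK : IsAdmissibleKernel K) :
    0 < kerHalfMoment K 0 * kerHalfMoment K 2 - kerHalfMoment K 1 ^ 2 := by
  have h0 := hK.halfMoment_pos 0
  have h := hK.half_sq_pos 0 (c := kerHalfMoment K 1) (d := -kerHalfMoment K 0)
    (Or.inl (hK.halfMoment_pos 1).ne')
  norm_num at h
  refine pos_of_mul_pos_right (a := kerHalfMoment K 0) ?_ h0.le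
  linarith

/-- The same argument one degree higher, with `c = ν̃₂` and `d = -ν̃₁`. -/
lemma half_bias_neg (hK : IsAdmissibleKernel K) :
    kerHalfMoment K 2 ^ 2 - kerHalfMoment K 1 * kerHalfMoment K 3 < 0 := by
  have h1 := hK.halfMoment_pos 1
  have h := hK.half_sq_pos 1 (c := kerHalfMoment K 2) (d := -kerHalfMoment K 1)
    (Or.inl (hK.halfMoment_pos 2).ne')
  norm_num at h
  have : 0 < kerHalfMoment K 1 * kerHalfMoment K 3 - kerHalfMoment K 2 ^ 2 := by
    refine pos_of_mul_pos_right (a := kerHalfMoment K 1) ?_ h1.le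
    linarith
  linarith

lemma rddC1_pos (hK : IsAdmissibleKernel K) : 0 < rddC1 K := by
  have := div_ne_zero hK.half_bias_neg.ne hK.half_det_pos.ne'
  unfold rddC1
  positivity

lemma rddC2_pos (hK : IsAdmissibleKernel K) : 0 < rddC2 K := by
  have h := hK.half_sq_pos' 0 (c := kerHalfMoment K 2) (d := -kerHalfMoment K 1)
    (Or.inl (hK.halfMoment_pos 2).ne')
  norm_num at h
  have hd := hK.half_det_pos
  unfold rddC2
  refine div_pos (by linarith) (pow_pos (by linarith) 2)

end IsAdmissibleKernel

lemma integral_Iic_eq_of_symm {g : ℝ → ℝ} (hs : ∀ u, g (-u) = g u) (j : ℕ) :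
    ∫ u in Set.Iic (0 : ℝ), u ^ j * g u = (-1) ^ j * ∫ u in Set.Ioi (0 : ℝ), u ^ j * g u := by
  have h := integral_comp_neg_Iic (0 : ℝ) (fun u => u ^ j * g u)
  rw [neg_zero] at h
  rw [← h, ← integral_const_mul]
  refine integral_congr_ae (Eventually.of_forall fun u => ?_)
  simp only [hs]
  rw [← mul_assoc, ← mul_pow]
  simp

lemma integral_eq_of_symm {g : ℝ → ℝ} (hg : IsWindow g) (hs : ∀ u, g (-u) = g u) (j : ℕ) :
    ∫ u, u ^ j * g u = (1 + (-1) ^ j) * ∫ u in Set.Ioi (0 : ℝ), u ^ j * g u := by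
  rw [add_mul, ← integral_Iic_eq_of_symm hs, one_mul, add_comm]
  exact (intervalIntegral.integral_Iic_add_Ioi (hg.pow_mul j).integrable.integrableOn
    (hg.pow_mul j).integrable.integrableOn).symm

namespace IsAdmissibleKernel

variable {K : ℝ → ℝ}

lemma kerMoment_eq (hK : IsAdmissibleKernel K) (j : ℕ) :
    kerMoment K j = (1 + (-1) ^ j) * kerHalfMoment K j :=
  integral_eq_of_symm hK.isWindow hK.symm j

lemma kerSqMoment_eq (hK : IsAdmissibleKernel K) (j : ℕ) :
    kerSqMoment K j = (1 + (-1) ^ j) * kerHalfSqMoment K j :=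
  integral_eq_of_symm hK.isWindow.sq (fun u => by rw [hK.symm]) j

/-- The odd moments vanish by symmetry, and the even ones are twice the half-line moments, a factor
that cancels here. -/
lemma tbdC1_eq (hK : IsAdmissibleKernel K) :
    tbdC1 K = 1 / 4 * (kerHalfMoment K 2 / kerHalfMoment K 0) ^ 2 := by
  have h0 := (hK.halfMoment_pos 0).ne'
  have h2 := (hK.halfMoment_pos 2).ne'
  rw [tbdC1]
  simp only [hK.kerMoment_eq]
  norm_num
  field_simp

lemma tbdC2_eq (hK : IsAdmissibleKernel K) :
    tbdC2 K = kerHalfSqMoment K 0 / kerHalfMoment K 0 ^ 2 := by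
  have h0 := (hK.halfMoment_pos 0).ne'
  have h2 := (hK.halfMoment_pos 2).ne'
  rw [tbdC2]
  simp only [hK.kerMoment_eq, hK.kerSqMoment_eq]
  norm_num
  field_simp

lemma tbdC1_pos (hK : IsAdmissibleKernel K) : 0 < tbdC1 K := by
  have h0 := hK.halfMoment_pos 0
  have h2 := hK.halfMoment_pos 2
  rw [hK.tbdC1_eq]
  positivity

lemma tbdC2_pos (hK : IsAdmissibleKernel K) : 0 < tbdC2 K := by
  have h0 := hK.halfMoment_pos 0
  have h2 := hK.halfSqMoment_pos 0
  rw [hK.tbdC2_eq]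
  positivity

lemma kerRatio_pos (hK : IsAdmissibleKernel K) : 0 < kerRatio K := by
  have := hK.rddC1_pos
  have := hK.rddC2_pos
  have := hK.tbdC1_pos
  have := hK.tbdC2_pos
  unfold kerRatio
  positivity

lemma thetaStar_pos (hK : IsAdmissibleKernel K) : 0 < thetaStar K := by
  have := hK.rddC1_pos
  have := hK.rddC2_pos
  have := hK.tbdC1_pos
  have := hK.tbdC2_pos
  unfold thetaStar
  positivity

lemma thetaStar_pow_four (hK : IsAdmissibleKernel K) : thetaStar K ^ 4 = (kerRatio K)⁻¹ := by
  have h : ∀ {x : ℝ}, 0 < x → (x ^ (1 / 4 : ℝ)) ^ 4 = x := fun {x} hx => by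
    rw [← Real.rpow_natCast, ← Real.rpow_mul hx.le]; norm_num
  rw [thetaStar, kerRatio, div_pow, mul_pow, mul_pow, h hK.tbdC1_pos, h hK.rddC1_pos, inv_div]

/-- Fifth powers of positive numbers clear the exponents: the condition becomes `θ ^ 4 * kerRatio K
= 1`, and `thetaStar K` is the positive fourth root. -/
lemma limit_eq_one_iff (hK : IsAdmissibleKernel K) {θ : ℝ} (hθ : 0 < θ) :
    θ ^ (4 / 5 : ℝ) * kerRatio K ^ (1 / 5 : ℝ) = 1 ↔ θ = thetaStar K := by
  have hR := hK.kerRatio_pos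
  have hpow : (θ ^ (4 / 5 : ℝ) * kerRatio K ^ (1 / 5 : ℝ)) ^ 5 = θ ^ 4 * kerRatio K := by
    rw [mul_pow, ← Real.rpow_natCast, ← Real.rpow_mul hθ.le, ← Real.rpow_natCast,
      ← Real.rpow_mul hR.le]
    norm_num
  have hnn : 0 ≤ θ ^ (4 / 5 : ℝ) * kerRatio K ^ (1 / 5 : ℝ) := by positivity
  rw [← pow_eq_one_iff_of_nonneg hnn (n := 5) (by norm_num), hpow,
    ← pow_left_inj₀ hθ.le hK.thetaStar_pos.le (n := 4) (by norm_num), hK.thetaStar_pow_four,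
    ← mul_eq_one_iff_eq_inv₀ hR.ne']

end IsAdmissibleKernel

/-! ### The triangular kernel -/

lemma isAdmissibleKernel_triangularKernel : IsAdmissibleKernel triangularKernel where
  nonneg u := le_max_left _ _
  symm u := by simp [triangularKernel]
  bdd := ⟨1, fun u => max_le zero_le_one (by linarith [abs_nonneg u])⟩
  supp u hu := max_eq_left (by linarith)
  cont := by unfold triangularKernel; fun_prop
  pos := ⟨0, by simp [triangularKernel]⟩

/-- The exponent `k = 0` must be excluded: `0 ^ 0 = 1` would keep the tail beyond `1`. -/
lemma integral_Ioi_triangularKernel (j k : ℕ) (hk : k ≠ 0) :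
    ∫ u in Set.Ioi (0 : ℝ), u ^ j * triangularKernel u ^ k =
      ∫ u in (0 : ℝ)..1, u ^ j * (1 - u) ^ k := by
  rw [intervalIntegral.integral_of_le zero_le_one,
    setIntegral_eq_of_subset_of_forall_sdiff_eq_zero measurableSet_Ioi
      (Set.Ioc_subset_Ioi_self : Set.Ioc (0 : ℝ) 1 ⊆ _)]
  · refine setIntegral_congr_fun measurableSet_Ioc fun u hu => ?_
    simp only [triangularKernel]
    rw [abs_of_pos hu.1, max_eq_right (by linarith [hu.2])]
  · intro u hu
    have h0 : (0 : ℝ) < u := hu.1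
    have h1 : 1 < u := not_le.1 fun h => hu.2 ⟨h0, h⟩
    rw [isAdmissibleKernel_triangularKernel.supp u (by rwa [abs_of_pos h0]), zero_pow hk,
      mul_zero]

lemma triangularKernel_halfMoment (j : ℕ) :
    kerHalfMoment triangularKernel j = 1 / (j + 1) - 1 / (j + 2) := by
  have h := integral_Ioi_triangularKernel j 1 one_ne_zero
  simp only [pow_one] at h
  rw [kerHalfMoment, h]
  have : ∀ u : ℝ, u ^ j * (1 - u) = u ^ j - u ^ (j + 1) := fun u => by ring
  simp only [this]
  rw [intervalIntegral.integral_sub ((continuous_pow _).intervalIntegrable _ _)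
    ((continuous_pow _).intervalIntegrable _ _), integral_pow, integral_pow]
  push_cast
  norm_num
  ring

lemma triangularKernel_halfSqMoment (j : ℕ) :
    kerHalfSqMoment triangularKernel j = 1 / (j + 1) - 2 / (j + 2) + 1 / (j + 3) := by
  rw [kerHalfSqMoment, integral_Ioi_triangularKernel j 2 two_ne_zero]
  have : ∀ u : ℝ, u ^ j * (1 - u) ^ 2 = u ^ j - 2 * u ^ (j + 1) + u ^ (j + 2) :=
    fun u => by ring
  simp only [this]
  have hi : ∀ k : ℕ, IntervalIntegrable (fun u : ℝ => u ^ k) volume 0 1 :=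
    fun k => (continuous_pow k).intervalIntegrable _ _
  rw [intervalIntegral.integral_add ((hi _).sub ((hi _).const_mul _)) (hi _),
    intervalIntegral.integral_sub (hi _) ((hi _).const_mul _),
    intervalIntegral.integral_const_mul, integral_pow, integral_pow, integral_pow]
  push_cast
  norm_num
  ring

lemma kerRatio_triangularKernel : kerRatio triangularKernel = 60.466176 := by
  rw [kerRatio, isAdmissibleKernel_triangularKernel.tbdC1_eq,
    isAdmissibleKernel_triangularKernel.tbdC2_eq, rddC1, rddC2]
  simp only [triangularKernel_halfMoment, triangularKernel_halfSqMoment]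
  norm_num

lemma abs_kerRatio_triangularKernel_rpow_sub_lt :
    |kerRatio triangularKernel ^ (1 / 5 : ℝ) - 2.27| < 0.005 := by
  have hpos : 0 < kerRatio triangularKernel := isAdmissibleKernel_triangularKernel.kerRatio_pos
  have h5 : (kerRatio triangularKernel ^ (1 / 5 : ℝ)) ^ 5 = 60.466176 := by
    rw [← Real.rpow_natCast, ← Real.rpow_mul hpos.le, kerRatio_triangularKernel]; norm_num
  have hnn : 0 ≤ kerRatio triangularKernel ^ (1 / 5 : ℝ) := by positivity
  rw [abs_sub_lt_iff]
  constructor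
  · have : kerRatio triangularKernel ^ (1 / 5 : ℝ) < 2.275 :=
      lt_of_pow_lt_pow_left₀ 5 (by norm_num) (by rw [h5]; norm_num)
    linarith
  · have : 2.265 < kerRatio triangularKernel ^ (1 / 5 : ℝ) :=
      lt_of_pow_lt_pow_left₀ 5 hnn (by rw [h5]; norm_num)
    linarith

/-- This interval lies in the rounding windows of both `0.359` and `0.36`. -/
lemma thetaStar_triangularKernel_bounds :
    0.3585 < thetaStar triangularKernel ∧ thetaStar triangularKernel < 0.359 := by
  have hpos := isAdmissibleKernel_triangularKernel.thetaStar_pos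
  have h4 := isAdmissibleKernel_triangularKernel.thetaStar_pow_four
  rw [kerRatio_triangularKernel] at h4
  constructor
  · exact lt_of_pow_lt_pow_left₀ 4 hpos.le (by rw [h4]; norm_num)
  · exact lt_of_pow_lt_pow_left₀ 4 (by norm_num) (by rw [h4]; norm_num)

/-! ### Designs with a treatment probability that depends on the assignment variable -/

/-- The potential outcome observed in an arm. -/
def armOutcome (b : Bool) (w : ℝ × ℝ × ℝ) : ℝ := if b then w.2.1 else w.2.2

/-- The value of the treatment in an arm. -/
def armValue (b : Bool) : ℝ := if b then 1 else -1

lemma measurable_armOutcome (b : Bool) : Measurable (armOutcome b) := by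
  cases b
  · exact measurable_snd.snd
  · exact measurable_snd.fst

/-- The observed response of subject `i`. -/
noncomputable def obsResponse {Ω : Type*} (W : ℕ → Ω → ℝ × ℝ × ℝ) (Z : ℕ → Ω → ℝ)
    (i : ℕ) (ω : Ω) : ℝ :=
  if Z i ω = 1 then (W i ω).2.1 else (W i ω).2.2

lemma obsResponse_of_arm {Ω : Type*} {W : ℕ → Ω → ℝ × ℝ × ℝ}
    {Z : ℕ → Ω → ℝ} {i : ℕ} {ω : Ω} {b : Bool}
    (hz : Z i ω = armValue b) :
    obsResponse W Z i ω = armOutcome b (W i ω) := by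
  cases b
  · have : ((-1 : ℝ) = 1) = False := by norm_num
    simp [obsResponse, armOutcome, hz, armValue, this]
  · simp [obsResponse, armOutcome, hz, armValue]

section Design

variable {Ω : Type*} [MeasurableSpace Ω]

/-- IID subjects, treated independently of one another, with treatment probability `p (X i)`. -/
structure IsDesign (P : Measure Ω) (D : Measure (ℝ × ℝ × ℝ)) (p : ℝ → ℝ)
    (W : ℕ → Ω → ℝ × ℝ × ℝ) (Z : ℕ → Ω → ℝ) : Prop where
  iid : IsIIDSample P D W
  meas : ∀ i, Measurable (Z i)
  values : ∀ i ω, Z i ω = 1 ∨ Z i ω = -1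
  indep : iIndepFun (fun i ω => (W i ω, Z i ω)) P
  prob_meas : Measurable p
  prob_nonneg : ∀ x, 0 ≤ p x
  prob_le_one : ∀ x, p x ≤ 1
  prob : ∀ i, P⟦Z i ⁻¹' {1} | MeasurableSpace.comap (W i) inferInstance⟧
    =ᵐ[P] fun ω => p (W i ω).1

lemma IsTBDSample.isDesign {P : Measure Ω} {D : Measure (ℝ × ℝ × ℝ)} {t Δ : ℝ}
    {W : ℕ → Ω → ℝ × ℝ × ℝ} {Z : ℕ → Ω → ℝ} (h : IsTBDSample P D t Δ W Z) :
    IsDesign P D (tbdProb t Δ) W Z where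
  iid := h.iid
  meas := h.meas
  values := h.values
  indep := h.indep
  prob_meas := Measurable.ite measurableSet_Iio measurable_const
    (Measurable.ite measurableSet_Iic measurable_const measurable_const)
  prob_nonneg x := by unfold tbdProb; split_ifs <;> norm_num
  prob_le_one x := by unfold tbdProb; split_ifs <;> norm_num
  prob := h.prob

/-- The treatment probability in the regression discontinuity design. -/
noncomputable def rddProb (t x : ℝ) : ℝ := if t < x then 1 else 0

lemma measurable_rddTreatment (t : ℝ) : Measurable (rddTreatment t) :=
  Measurable.ite measurableSet_Ioi measurable_const measurable_const

/-- The degenerate case in which treatment is a function of `X`; the treated event is then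
measurable with respect to `W i` and is its own conditional probability. Both designs thus fall
under one asymptotic theorem. -/
lemma IsIIDSample.isDesign_rdd {P : Measure Ω} [IsProbabilityMeasure P]
    {D : Measure (ℝ × ℝ × ℝ)} {W : ℕ → Ω → ℝ × ℝ × ℝ} (h : IsIIDSample P D W) (t : ℝ) :
    IsDesign P D (rddProb t) W (fun i ω => rddTreatment t (W i ω).1) where
  iid := h
  meas i := (measurable_rddTreatment t).comp (h.meas i).fst
  values i ω := by unfold rddTreatment; split_ifs <;> simp
  indep := h.indep.comp (fun _ w => (w, rddTreatment t w.1))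
    fun _ => measurable_id.prodMk ((measurable_rddTreatment t).comp measurable_fst)
  prob_meas := Measurable.ite measurableSet_Ioi measurable_const measurable_const
  prob_nonneg x := by unfold rddProb; split_ifs <;> norm_num
  prob_le_one x := by unfold rddProb; split_ifs <;> norm_num
  prob i := by
    have hset : ∀ ω, ((fun ω => rddTreatment t (W i ω).1) ⁻¹' {1}).indicator
        (fun _ => (1 : ℝ)) ω = rddProb t (W i ω).1 := by
      intro ω
      unfold rddTreatment rddProb
      by_cases hlt : t < (W i ω).1
      · simp [hlt]
      · have : ((-1 : ℝ) = 1) = False := by norm_num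
        simp [hlt, this]
    rw [funext hset]
    have hm : Measurable (rddProb t) :=
      Measurable.ite measurableSet_Ioi measurable_const measurable_const
    refine (condExp_of_stronglyMeasurable (h.meas i).comap_le ?_ ?_).eventuallyEq
    · exact ((hm.comp measurable_fst).comp (comap_measurable (W i))).stronglyMeasurable
    · refine Integrable.of_bound (C := 1)
        (hm.comp (h.meas i).fst).aestronglyMeasurable (Eventually.of_forall fun ω => ?_)
      unfold rddProb
      split_ifs <;> norm_num

/-- The probability of belonging to an arm. -/
def armProb (p : ℝ → ℝ) (b : Bool) (x : ℝ) : ℝ := if b then p x else 1 - p x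

variable {P : Measure Ω} {D : Measure (ℝ × ℝ × ℝ)}
  {p : ℝ → ℝ} {W : ℕ → Ω → ℝ × ℝ × ℝ} {Z : ℕ → Ω → ℝ}

namespace IsDesign

lemma armProb_nonneg (h : IsDesign P D p W Z) (b : Bool) (x : ℝ) : 0 ≤ armProb p b x := by
  cases b
  · simpa [armProb] using h.prob_le_one x
  · simpa [armProb] using h.prob_nonneg x

lemma armProb_le_one (h : IsDesign P D p W Z) (b : Bool) (x : ℝ) : armProb p b x ≤ 1 := by
  cases b
  · simpa [armProb] using h.prob_nonneg x
  · simpa [armProb] using h.prob_le_one x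

lemma measurable_armProb (h : IsDesign P D p W Z) (b : Bool) : Measurable (armProb p b) := by
  cases b
  · exact measurable_const.sub h.prob_meas
  · exact h.prob_meas

lemma measurableSet_arm (h : IsDesign P D p W Z) (i : ℕ) (b : Bool) :
    MeasurableSet {ω | Z i ω = armValue b} := h.meas i (measurableSet_singleton _)

/-- The defining property of conditional probability, integrated over the event `W i ∈ A`. -/
lemma measure_treated [IsProbabilityMeasure P] (h : IsDesign P D p W Z) (i : ℕ)
    {A : Set (ℝ × ℝ × ℝ)}
    (hA : MeasurableSet A) :
    P.real (W i ⁻¹' A ∩ Z i ⁻¹' {1}) = ∫ w in A, p w.1 ∂D := by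
  have hW := h.iid.meas i
  have hZ : MeasurableSet (Z i ⁻¹' {1}) := h.meas i (measurableSet_singleton _)
  have h1 := setIntegral_condExp (μ := P) (m := MeasurableSpace.comap (W i) inferInstance)
    hW.comap_le (f := (Z i ⁻¹' {1}).indicator fun _ => (1 : ℝ))
    ((integrable_const _).indicator hZ) (s := W i ⁻¹' A) ⟨A, hA, rfl⟩
  rw [integral_indicator_const _ hZ, smul_eq_mul, mul_one,
    measureReal_restrict_apply hZ, Set.inter_comm] at h1
  rw [← h1, ← h.iid.law i, setIntegral_map (f := fun w : ℝ × ℝ × ℝ => p w.1) hA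
    (h.prob_meas.comp measurable_fst).aestronglyMeasurable hW.aemeasurable]
  exact (setIntegral_congr_ae (hW hA) ((h.prob i).mono fun ω hω _ => hω))

/-- The law of `W i` on the event that subject `i` is in an arm. -/
lemma map_restrict_arm [IsProbabilityMeasure P] (h : IsDesign P D p W Z) (i : ℕ) (b : Bool) :
    (P.restrict {ω | Z i ω = armValue b}).map (W i) =
      D.withDensity (fun w => ENNReal.ofReal (armProb p b w.1)) := by
  have hW := h.iid.meas i
  have : IsProbabilityMeasure D := by
    rw [← h.iid.law i]; exact Measure.isProbabilityMeasure_map hW.aemeasurable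
  have hint : ∀ b, Integrable (fun w : ℝ × ℝ × ℝ => armProb p b w.1) D := fun b =>
    Integrable.of_bound (C := 1) ((h.measurable_armProb b).comp measurable_fst).aestronglyMeasurable
      (Eventually.of_forall fun w => by
        rw [Real.norm_eq_abs, abs_of_nonneg (h.armProb_nonneg b _)]
        exact h.armProb_le_one b _)
  ext A hA
  rw [Measure.map_apply hW hA, Measure.restrict_apply (hW hA), withDensity_apply _ hA,
    ← ofReal_integral_eq_lintegral_ofReal (hint b).integrableOn
      (Eventually.of_forall fun w => h.armProb_nonneg b _), ← ofReal_measureReal]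
  congr 1
  cases b
  -- The untreated arm is the complement of the treated one, so its law follows by subtraction.
  · have hsplit := measureReal_inter_add_sdiff (μ := P) (s := W i ⁻¹' A)
      (h.measurableSet_arm i true)
    have hset : W i ⁻¹' A \ {ω | Z i ω = armValue true} =
        W i ⁻¹' A ∩ {ω | Z i ω = armValue false} := by
      ext ω
      rcases h.values i ω with hz | hz <;> simp [armValue, hz] <;> norm_num
    have h1 : P.real (W i ⁻¹' A ∩ {ω | Z i ω = armValue true}) = ∫ w in A, p w.1 ∂D :=
      h.measure_treated i hA
    have hA' : P.real (W i ⁻¹' A) = D.real A := by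
      rw [← h.iid.law i, map_measureReal_apply hW hA]
    rw [hset, h1, hA'] at hsplit
    have hsub : ∫ w in A, armProb p false w.1 ∂D = D.real A - ∫ w in A, p w.1 ∂D := by
      simp only [armProb, Bool.false_eq_true, if_false]
      rw [integral_sub (g := fun w : ℝ × ℝ × ℝ => p w.1) (integrable_const _)
        (hint true).integrableOn]
      simp
    rw [hsub]
    linarith
  · exact h.measure_treated i hA

lemma setLIntegral_arm [IsProbabilityMeasure P] (h : IsDesign P D p W Z) (i : ℕ)
    (b : Bool) {φ : ℝ × ℝ × ℝ → ℝ≥0∞}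
    (hφ : Measurable φ) :
    ∫⁻ ω in {ω | Z i ω = armValue b}, φ (W i ω) ∂P =
      ∫⁻ w, ENNReal.ofReal (armProb p b w.1) * φ w ∂D := by
  rw [← lintegral_map hφ (h.iid.meas i), h.map_restrict_arm,
    lintegral_withDensity_eq_lintegral_mul _ _ hφ]
  · rfl
  · exact ((h.measurable_armProb b).comp measurable_fst).ennreal_ofReal

lemma setIntegral_arm [IsProbabilityMeasure P] (h : IsDesign P D p W Z) (i : ℕ)
    (b : Bool) {g : ℝ × ℝ × ℝ → ℝ}
    (hg : Measurable g) :
    ∫ ω in {ω | Z i ω = armValue b}, g (W i ω) ∂P = ∫ w, armProb p b w.1 * g w ∂D := by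
  rw [← integral_map (h.iid.meas i).aemeasurable hg.aestronglyMeasurable, h.map_restrict_arm,
    integral_withDensity_eq_integral_toReal_smul
      (f := fun w : ℝ × ℝ × ℝ => ENNReal.ofReal (armProb p b w.1))
      ((h.measurable_armProb b).comp measurable_fst).ennreal_ofReal
      (Eventually.of_forall fun w => ENNReal.ofReal_lt_top)]
  refine integral_congr_ae (Eventually.of_forall fun w => ?_)
  simp [ENNReal.toReal_ofReal (h.armProb_nonneg b w.1)]

lemma lintegral_eq_add_arm (h : IsDesign P D p W Z) (i : ℕ) (φ : Ω → ℝ≥0∞) :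
    ∫⁻ ω, φ ω ∂P = ∫⁻ ω in {ω | Z i ω = armValue true}, φ ω ∂P +
      ∫⁻ ω in {ω | Z i ω = armValue false}, φ ω ∂P := by
  rw [← lintegral_add_compl φ (h.measurableSet_arm i true)]
  congr 2
  congr 1
  ext ω
  rcases h.values i ω with hz | hz <;> simp [armValue, hz] <;> norm_num

end IsDesign

/-! ### The conditional law of the responses -/

lemma measurableSet_treated : MeasurableSet {d : ℝ × ℝ | d.2 = 1} :=
  measurable_snd (measurableSet_singleton _)

/-- The conditional law of the response of a subject, given the assignment variable and the
treatment. -/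
noncomputable def responseKernel (D : Measure (ℝ × ℝ × ℝ)) [IsFiniteMeasure D] :
    Kernel (ℝ × ℝ) ℝ :=
  Kernel.piecewise measurableSet_treated
    ((condDistrib (armOutcome true) (fun w => w.1) D).comap Prod.fst measurable_fst)
    ((condDistrib (armOutcome false) (fun w => w.1) D).comap Prod.fst measurable_fst)

instance (D : Measure (ℝ × ℝ × ℝ)) [IsFiniteMeasure D] : IsMarkovKernel (responseKernel D) := by
  unfold responseKernel; infer_instance

lemma responseKernel_armValue (D : Measure (ℝ × ℝ × ℝ)) [IsFiniteMeasure D] (b : Bool) (x : ℝ) :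
    responseKernel D (x, armValue b) = condDistrib (armOutcome b) (fun w => w.1) D x := by
  rw [responseKernel, Kernel.piecewise_apply]
  cases b
  · have : ((-1 : ℝ) = 1) = False := by norm_num
    simp [armValue, this]
  · simp [armValue]

/-- The conditional law of the responses of `N` subjects given the design. -/
noncomputable def jointResponseKernel (D : Measure (ℝ × ℝ × ℝ)) [IsFiniteMeasure D] (N : ℕ) :
    Kernel ((Fin N → ℝ) × (Fin N → ℝ)) (Fin N → ℝ) where
  toFun d := Measure.pi fun i => responseKernel D (d.1 i, d.2 i)
  measurable' := by
    -- Measurability need only be checked on boxes, where the product measure is a finite product.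
    refine Measurable.measure_of_isPiSystem_of_isProbabilityMeasure generateFrom_pi.symm
      isPiSystem_pi ?_
    rintro _ ⟨s, hs, rfl⟩
    simp only [Measure.pi_pi]
    refine Finset.measurable_prod _ fun i _ => ?_
    exact ((responseKernel D).measurable_coe (hs i (Set.mem_univ i))).comp
      (f := fun d : (Fin N → ℝ) × (Fin N → ℝ) => (d.1 i, d.2 i)) (by fun_prop)

lemma jointResponseKernel_apply (D : Measure (ℝ × ℝ × ℝ)) [IsFiniteMeasure D] {N : ℕ}
    (d : (Fin N → ℝ) × (Fin N → ℝ)) :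
    jointResponseKernel D N d = Measure.pi fun i => responseKernel D (d.1 i, d.2 i) := rfl

instance (D : Measure (ℝ × ℝ × ℝ)) [IsFiniteMeasure D] (N : ℕ) :
    IsMarkovKernel (jointResponseKernel D N) :=
  ⟨fun d => by rw [jointResponseKernel_apply]; infer_instance⟩

namespace IsDesign

lemma measurable_obsResponse (h : IsDesign P D p W Z) (i : ℕ) :
    Measurable (obsResponse W Z i) :=
  Measurable.ite (h.meas i (measurableSet_singleton _)) (h.iid.meas i).snd.fst
    (h.iid.meas i).snd.snd

/-- Restricting to an arm reweights `D` by a function of `X` alone, which leaves the conditional law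
of the potential outcome given `X` unchanged. This is where independence of treatment and outcomes
given `X` is used. -/
lemma setLIntegral_arm_indicator [IsProbabilityMeasure P] [IsFiniteMeasure D]
    (h : IsDesign P D p W Z) (i : ℕ)
    (b : Bool) {S : Set ((ℝ × ℝ) × ℝ)} (hS : MeasurableSet S) :
    ∫⁻ ω in {ω | Z i ω = armValue b},
        S.indicator 1 (((W i ω).1, Z i ω), obsResponse W Z i ω) ∂P =
      ∫⁻ ω in {ω | Z i ω = armValue b},
        responseKernel D ((W i ω).1, Z i ω) (Prod.mk ((W i ω).1, Z i ω) ⁻¹' S) ∂P := by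
  have hind : Measurable (S.indicator (1 : (ℝ × ℝ) × ℝ → ℝ≥0∞)) := measurable_one.indicator hS
  have hemb : Measurable fun q : ℝ × ℝ => ((q.1, armValue b), q.2) := by fun_prop
  have hS' : MeasurableSet ((fun q : ℝ × ℝ => ((q.1, armValue b), q.2)) ⁻¹' S) := hemb hS
  have e1 : ∫⁻ ω in {ω | Z i ω = armValue b},
        S.indicator 1 (((W i ω).1, Z i ω), obsResponse W Z i ω) ∂P =
      ∫⁻ w, ENNReal.ofReal (armProb p b w.1) *
        S.indicator 1 ((w.1, armValue b), armOutcome b w) ∂D := by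
    rw [← h.setLIntegral_arm i b (φ := fun w =>
      S.indicator 1 ((w.1, armValue b), armOutcome b w))
      (hind.comp ((measurable_fst.prodMk measurable_const).prodMk (measurable_armOutcome b)))]
    refine setLIntegral_congr_fun (h.measurableSet_arm i b) fun ω hω => ?_
    have hz : Z i ω = armValue b := hω
    simp only [obsResponse_of_arm hz, hz]
  have hker : Measurable fun x : ℝ => condDistrib (armOutcome b) (fun w => w.1) D x
      (Prod.mk x ⁻¹' ((fun q : ℝ × ℝ => ((q.1, armValue b), q.2)) ⁻¹' S)) :=
    Kernel.measurable_kernel_prodMk_left hS'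
  have e2 : ∫⁻ ω in {ω | Z i ω = armValue b},
        responseKernel D ((W i ω).1, Z i ω) (Prod.mk ((W i ω).1, Z i ω) ⁻¹' S) ∂P =
      ∫⁻ w, ENNReal.ofReal (armProb p b w.1) * condDistrib (armOutcome b) (fun w => w.1) D w.1
        (Prod.mk w.1 ⁻¹' ((fun q : ℝ × ℝ => ((q.1, armValue b), q.2)) ⁻¹' S)) ∂D := by
    rw [← h.setLIntegral_arm i b (φ := fun w => condDistrib (armOutcome b) (fun w => w.1) D w.1
        (Prod.mk w.1 ⁻¹' ((fun q : ℝ × ℝ => ((q.1, armValue b), q.2)) ⁻¹' S)))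
        (hker.comp measurable_fst)]
    refine setLIntegral_congr_fun (h.measurableSet_arm i b) fun ω hω => ?_
    have hz : Z i ω = armValue b := hω
    simp only [hz, responseKernel_armValue]
    rfl
  rw [e1, e2]
  have hq : Measurable fun x : ℝ => ENNReal.ofReal (armProb p b x) :=
    (h.measurable_armProb b).ennreal_ofReal
  have hφ : Measurable fun q : ℝ × ℝ => ENNReal.ofReal (armProb p b q.1) *
      S.indicator 1 ((q.1, armValue b), q.2) :=
    (hq.comp measurable_fst).mul (hind.comp hemb)
  have hmap := lintegral_map (μ := D) hφ (measurable_fst.prodMk (measurable_armOutcome b))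
  -- Disintegration of the law of `(X, Y)`: the arm probability is constant in the inner integral
  -- and comes out.
  rw [← hmap, ← compProd_map_condDistrib (measurable_armOutcome b).aemeasurable,
    Measure.lintegral_compProd hφ, lintegral_map _ measurable_fst]
  · refine lintegral_congr fun w => ?_
    have hm : Measurable fun y : ℝ => S.indicator (1 : (ℝ × ℝ) × ℝ → ℝ≥0∞)
        ((w.1, armValue b), y) := hind.comp (by fun_prop)
    dsimp only
    rw [lintegral_const_mul _ hm]
    congr 1
    have : (fun y => S.indicator (1 : (ℝ × ℝ) × ℝ → ℝ≥0∞) ((w.1, armValue b), y)) =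
        (Prod.mk w.1 ⁻¹' ((fun q : ℝ × ℝ => ((q.1, armValue b), q.2)) ⁻¹' S)).indicator 1 := by
      rfl
    rw [this, lintegral_indicator_one (measurable_prodMk_left hS')]
  · exact hφ.lintegral_kernel_prod_right'

/-- The joint law of assignment variable, treatment and response of a subject. -/
lemma map_eq_compProd [IsProbabilityMeasure P] [IsFiniteMeasure D]
    (h : IsDesign P D p W Z) (i : ℕ) :
    P.map (fun ω => (((W i ω).1, Z i ω), obsResponse W Z i ω)) =
      P.map (fun ω => ((W i ω).1, Z i ω)) ⊗ₘ responseKernel D := by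
  have hd : Measurable fun ω => ((W i ω).1, Z i ω) := (h.iid.meas i).fst.prodMk (h.meas i)
  have hT := hd.prodMk (h.measurable_obsResponse i)
  ext S hS
  rw [Measure.compProd_apply hS, lintegral_map (Kernel.measurable_kernel_prodMk_left hS) hd,
    ← lintegral_indicator_one hS, lintegral_map (measurable_one.indicator hS) hT,
    h.lintegral_eq_add_arm i, h.lintegral_eq_add_arm i, h.setLIntegral_arm_indicator i true hS,
    h.setLIntegral_arm_indicator i false hS]

end IsDesign

end Design

section ConditionalLaw

variable {Ω : Type*} [MeasurableSpace Ω] {P : Measure Ω}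
  {D : Measure (ℝ × ℝ × ℝ)} {p : ℝ → ℝ} {W : ℕ → Ω → ℝ × ℝ × ℝ} {Z : ℕ → Ω → ℝ}

namespace IsDesign

/-- The joint law of the designs and the responses of the first `N` subjects. -/
lemma map_design_response_eq_compProd [IsProbabilityMeasure P] [IsFiniteMeasure D]
    (h : IsDesign P D p W Z) (N : ℕ) :
    P.map (fun ω => (designOf W Z N ω, responseOf W Z N ω)) =
      P.map (designOf W Z N) ⊗ₘ jointResponseKernel D N := by
  have hd : ∀ i, Measurable fun ω => ((W i ω).1, Z i ω) :=
    fun i => (h.iid.meas i).fst.prodMk (h.meas i)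
  have hT : ∀ i, Measurable fun ω => (((W i ω).1, Z i ω), obsResponse W Z i ω) :=
    fun i => (hd i).prodMk (h.measurable_obsResponse i)
  have hdes : Measurable (designOf W Z N) :=
    (measurable_pi_lambda _ fun i : Fin N => (h.iid.meas i).fst).prodMk
      (measurable_pi_lambda _ fun i : Fin N => h.meas i)
  -- `χ` regroups the data by subject, where independence is a product measure, and `ψ` undoes this.
  let ψ : (Fin N → (ℝ × ℝ) × ℝ) → ((Fin N → ℝ) × (Fin N → ℝ)) × (Fin N → ℝ) :=
    fun q => ((fun i => (q i).1.1, fun i => (q i).1.2), fun i => (q i).2)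
  let χ : ((Fin N → ℝ) × (Fin N → ℝ)) × (Fin N → ℝ) → (Fin N → (ℝ × ℝ) × ℝ) :=
    fun q i => ((q.1.1 i, q.1.2 i), q.2 i)
  have hψ : Measurable ψ := by fun_prop
  have hχ : Measurable χ := by fun_prop
  have hindep : iIndepFun (fun (i : Fin N) ω => (((W i ω).1, Z i ω), obsResponse W Z i ω)) P := by
    have h1 : iIndepFun (fun (i : Fin N) ω => (W i ω, Z i ω)) P :=
      h.indep.precomp Fin.val_injective
    refine h1.comp (fun _ q => ((q.1.1, q.2), if q.2 = 1 then q.1.2.1 else q.1.2.2)) fun _ => ?_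
    exact (measurable_fst.fst.prodMk measurable_snd).prodMk
      (Measurable.ite (measurable_snd (measurableSet_singleton (1 : ℝ))) measurable_fst.snd.fst
        measurable_fst.snd.snd)
  have hindep' : iIndepFun (fun (i : Fin N) ω => ((W i ω).1, Z i ω)) P :=
    hindep.comp (fun _ q => q.1) fun _ => measurable_fst
  have hlaw : P.map (fun ω (i : Fin N) => (((W i ω).1, Z i ω), obsResponse W Z i ω)) =
      Measure.pi fun i : Fin N => P.map fun ω => (((W i ω).1, Z i ω), obsResponse W Z i ω) :=
    hindep.map_fun_eq_pi_map fun i => (hT i).aemeasurable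
  have hpi : (P.map (designOf W Z N) ⊗ₘ jointResponseKernel D N).map χ =
      Measure.pi fun i : Fin N => P.map fun ω => (((W i ω).1, Z i ω), obsResponse W Z i ω) := by
    refine (Measure.pi_eq fun s hs => ?_).symm
    have hpre : MeasurableSet (χ ⁻¹' Set.univ.pi s) := hχ (MeasurableSet.univ_pi hs)
    rw [Measure.map_apply hχ (MeasurableSet.univ_pi hs), Measure.compProd_apply hpre,
      lintegral_map (Kernel.measurable_kernel_prodMk_left hpre) hdes]
    have hfac : ∀ ω, jointResponseKernel D N (designOf W Z N ω)
        (Prod.mk (designOf W Z N ω) ⁻¹' (χ ⁻¹' Set.univ.pi s)) =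
        ∏ i : Fin N, responseKernel D ((W i ω).1, Z i ω)
          (Prod.mk ((W i ω).1, Z i ω) ⁻¹' s i) := by
      intro ω
      have : Prod.mk (designOf W Z N ω) ⁻¹' (χ ⁻¹' Set.univ.pi s) =
          Set.univ.pi fun i : Fin N => Prod.mk ((W i ω).1, Z i ω) ⁻¹' s i := by
        ext y
        simp [χ, designOf, Set.mem_pi]
      rw [this, jointResponseKernel_apply, Measure.pi_pi]
      rfl
    have hmeas : ∀ i : Fin N, Measurable fun d : ℝ × ℝ =>
        responseKernel D d (Prod.mk d ⁻¹' s i) :=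
      fun i => Kernel.measurable_kernel_prodMk_left (hs i)
    -- The kernel of a box is a product over subjects; independence of the designs exchanges product
    -- and integral.
    rw [lintegral_congr hfac, lintegral_prod_eq_prod_lintegral_of_indepFun Finset.univ
      (fun (i : Fin N) ω => responseKernel D ((W i ω).1, Z i ω)
          (Prod.mk ((W i ω).1, Z i ω) ⁻¹' s i))
      (hindep'.comp _ hmeas) (fun i => (hmeas i).comp (hd i))]
    refine Finset.prod_congr rfl fun i _ => ?_
    rw [h.map_eq_compProd i, Measure.compProd_apply (hs i),
      lintegral_map (Kernel.measurable_kernel_prodMk_left (hs i)) (hd i)]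
  have hψχ : ψ ∘ χ = id := rfl
  rw [← Measure.map_id (μ := P.map (designOf W Z N) ⊗ₘ jointResponseKernel D N), ← hψχ,
    ← Measure.map_map hψ hχ, hpi, ← hlaw, Measure.map_map hψ (measurable_pi_lambda _ fun i => hT i)]
  rfl

/-- Almost sure uniqueness of disintegrations. The null set involves no bandwidth. -/
lemma condDistrib_response_ae_eq [IsProbabilityMeasure P] [IsFiniteMeasure D]
    (h : IsDesign P D p W Z) (N : ℕ) :
    ∀ᵐ ω ∂P, condDistrib (responseOf W Z N) (designOf W Z N) P (designOf W Z N ω) =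
      Measure.pi fun i : Fin N => responseKernel D ((W i ω).1, Z i ω) := by
  have hdes : Measurable (designOf W Z N) :=
    (measurable_pi_lambda _ fun i : Fin N => (h.iid.meas i).fst).prodMk
      (measurable_pi_lambda _ fun i : Fin N => h.meas i)
  have hres : Measurable (responseOf W Z N) :=
    measurable_pi_lambda _ fun i => h.measurable_obsResponse i
  have := condDistrib_ae_eq_of_measure_eq_compProd (designOf W Z N) hres.aemeasurable
    (h.map_design_response_eq_compProd N)
  exact ae_of_ae_map hdes.aemeasurable this

end IsDesign

/-- The second moment of an affine function of independent coordinates. -/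
lemma integral_sq_affine_pi {ι : Type*} [Fintype ι] {ρ : ι → Measure ℝ}
    [∀ i, IsProbabilityMeasure (ρ i)] (hρ : ∀ i, MemLp id 2 (ρ i)) (c : ι → ℝ) (τ : ℝ) :
    ∫ y, (∑ i, c i * y i - τ) ^ 2 ∂(Measure.pi ρ) =
      (∑ i, c i * ∫ y, y ∂(ρ i) - τ) ^ 2 + ∑ i, c i ^ 2 * Var[id; ρ i] := by
  have hc : ∀ i, MemLp (fun y => c i * y) 2 (ρ i) := fun i => (hρ i).const_mul (c i)
  have hci : ∀ i, MemLp (fun y : ι → ℝ => c i * y i) 2 (Measure.pi ρ) := fun i =>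
    (hc i).comp_measurePreserving (measurePreserving_eval ρ i)
  have hsum : MemLp (fun y : ι → ℝ => ∑ i, c i * y i) 2 (Measure.pi ρ) :=
    memLp_finsetSum _ fun i _ => hci i
  have hmean : ∫ y, ∑ i, c i * y i ∂(Measure.pi ρ) = ∑ i, c i * ∫ y, y ∂(ρ i) := by
    rw [integral_finsetSum _ fun i _ => (hci i).integrable one_le_two]
    refine Finset.sum_congr rfl fun i _ => ?_
    rw [integral_comp_eval (μ := ρ) (i := i) (f := fun y : ℝ => c i * y)
      (hc i).aestronglyMeasurable,
      integral_const_mul]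
  have hvar : Var[fun y : ι → ℝ => ∑ i, c i * y i; Measure.pi ρ] =
      ∑ i, c i ^ 2 * Var[id; ρ i] := by
    have h1 := variance_sum_pi hc
    have h2 : (∑ i, fun y : ι → ℝ => c i * y i) = fun y => ∑ i, c i * y i := by
      ext y; simp
    rw [h2] at h1
    rw [h1]
    exact Finset.sum_congr rfl fun i _ => variance_const_mul _ _ _
  have hsub : MemLp (fun y : ι → ℝ => ∑ i, c i * y i - τ) 2 (Measure.pi ρ) :=
    hsum.sub (memLp_const τ)
  -- Second moment equals variance plus squared mean; the shift by `τ` affects only the mean.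
  have hv := variance_eq_sub hsub
  rw [variance_sub_const hsum.aestronglyMeasurable, hvar,
    integral_sub (hsum.integrable one_le_two) (integrable_const τ), hmean] at hv
  simp only [integral_const, probReal_univ, one_smul] at hv
  have e : ∫ y, ((fun y : ι → ℝ => ∑ i, c i * y i - τ) ^ 2) y ∂(Measure.pi ρ) =
    ∫ y, (∑ i, c i * y i - τ) ^ 2 ∂(Measure.pi ρ) := rfl
  rw [e] at hv
  linarith

/-- The conditional means and variances of the observed response, arm by arm. -/
def armFun (gp gm : ℝ → ℝ) (b : Bool) : ℝ → ℝ := if b then gp else gm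

lemma IsDesign.responseKernel_moments_ae [IsProbabilityMeasure D] (h : IsDesign P D p W Z)
    {μp μm vp vm : ℝ → ℝ}
    (hp : HasCondMeanVar D (fun w => w.1) (fun w => w.2.1) μp vp)
    (hm : HasCondMeanVar D (fun w => w.1) (fun w => w.2.2) μm vm) :
    ∀ᵐ ω ∂P, ∀ i b, Z i ω = armValue b →
      MemLp id 2 (responseKernel D ((W i ω).1, Z i ω)) ∧
      ∫ y, y ∂(responseKernel D ((W i ω).1, Z i ω)) = armFun μp μm b (W i ω).1 ∧
      Var[id; responseKernel D ((W i ω).1, Z i ω)] = armFun vp vm b (W i ω).1 := by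
  rw [ae_all_iff]
  intro i
  have hX : P.map (fun ω => (W i ω).1) = D.map fun w => w.1 := by
    rw [← h.iid.law i, Measure.map_map measurable_fst (h.iid.meas i)]
    rfl
  unfold HasCondMeanVar at hp hm
  rw [← hX] at hp hm
  filter_upwards [ae_of_ae_map (h.iid.meas i).fst.aemeasurable hp,
    ae_of_ae_map (h.iid.meas i).fst.aemeasurable hm] with ω h1 h2 b hz
  rw [hz, responseKernel_armValue]
  cases b
  · exact h2
  · exact h1

/-- The mean squared error in terms of the weights of the two local linear fits. -/
theorem IsDesign.condMSE_ae_eq [IsProbabilityMeasure P] [IsProbabilityMeasure D]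
    (h : IsDesign P D p W Z)
    {μp μm vp vm : ℝ → ℝ}
    (hp : HasCondMeanVar D (fun w => w.1) (fun w => w.2.1) μp vp)
    (hm : HasCondMeanVar D (fun w => w.1) (fun w => w.2.2) μm vm)
    {K : ℝ → ℝ} {t : ℝ} {βhat : FitRule} (hβ : IsLocalLinearFit K t βhat) (τ : ℝ) (N : ℕ) :
    ∀ᵐ ω ∂P, ∀ a : ℝ, a ≠ 0 → ∀ w : Bool → Fin N → ℝ,
      (w = fun b => fitWeight (armWeight K t a b (designOf W Z N ω).1 (designOf W Z N ω).2)
        (fun i => ((W i ω).1 - t) / a)) →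
      (∀ b, fitDet (armWeight K t a b (designOf W Z N ω).1 (designOf W Z N ω).2)
        (fun i => ((W i ω).1 - t) / a) ≠ 0) →
      condMSE P βhat t τ W Z a N ω =
        (∑ i, w true i * μp (W i ω).1 - ∑ i, w false i * μm (W i ω).1 - τ) ^ 2 +
          (∑ i, w true i ^ 2 * vp (W i ω).1 + ∑ i, w false i ^ 2 * vm (W i ω).1) := by
  -- Both null sets are chosen before `a`, so the formula can later be evaluated at a bandwidth
  -- depending on `ω`.
  filter_upwards [h.condDistrib_response_ae_eq N, h.responseKernel_moments_ae hp hm]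
    with ω hcd hmom a ha w hw hdet
  have hz : ∀ i : Fin N, Z i ω = 1 ∨ Z i ω = -1 := fun i => h.values i ω
  have hb : ∀ i : Fin N, ∃ b, Z i ω = armValue b := fun i => by
    rcases hz i with hi | hi
    · exact ⟨true, hi⟩
    · exact ⟨false, hi⟩
  have hmem : ∀ i : Fin N, MemLp id 2 (responseKernel D ((W i ω).1, Z i ω)) := fun i => by
    obtain ⟨b, hi⟩ := hb i
    exact (hmom i b hi).1
  have htau := tauHat_eq_sum_contrastWeight hβ ha (x := (designOf W Z N ω).1)
    (z := (designOf W Z N ω).2) hz hdet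
  have hcw : ∀ i, contrastWeight K t a (designOf W Z N ω).1 (designOf W Z N ω).2 i =
      w true i - w false i := fun i => by rw [hw]; rfl
  -- Each subject carries weight only in its own arm, so the cross terms in `(w true i - w false i)
  -- ^ 2` vanish.
  have hoff : ∀ (i : Fin N) b, Z i ω = armValue b → w (!b) i = 0 := by
    intro i b hi
    have hi' : (designOf W Z N ω).2 i = armValue b := hi
    have : ((-1 : ℝ) = 1) = False := by norm_num
    rw [hw]
    cases b <;> simp [fitWeight, armWeight, armIndicator, hi', armValue, this]
  have hint : condMSE P βhat t τ W Z a N ω =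
      ∫ y, (∑ i, (w true i - w false i) * y i - τ) ^ 2
        ∂(Measure.pi fun i : Fin N => responseKernel D ((W i ω).1, Z i ω)) := by
    rw [condMSE, hcd]
    refine integral_congr_ae (Eventually.of_forall fun y => ?_)
    simp only
    rw [htau y]
    simp only [hcw]
  rw [hint, integral_sq_affine_pi hmem, ← Finset.sum_sub_distrib, ← Finset.sum_add_distrib]
  congr 3
  · refine Finset.sum_congr rfl fun i _ => ?_
    obtain ⟨b, hi⟩ := hb i
    rw [(hmom i b hi).2.1]
    have := hoff i b hi
    cases b
    · simp only [Bool.not_false] at this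
      rw [this]
      simp [armFun]
    · simp only [Bool.not_true] at this
      rw [this]
      simp [armFun]
  · ext i
    obtain ⟨b, hi⟩ := hb i
    rw [(hmom i b hi).2.2]
    have := hoff i b hi
    cases b
    · simp only [Bool.not_false] at this
      rw [this]
      simp [armFun]
    · simp only [Bool.not_true] at this
      rw [this]
      simp [armFun]

end ConditionalLaw

/-! ### Local averages over an arm -/

/-- The arm probabilities near the threshold `t` are the functions `r b` of the rescaled assignment
variable, at every small scale. -/
structure HasLocalShape (p : ℝ → ℝ) (t : ℝ) (r : Bool → ℝ → ℝ) : Prop where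
  meas : ∀ b, Measurable (r b)
  nonneg : ∀ b u, 0 ≤ r b u
  le_one : ∀ b u, r b u ≤ 1
  -- The range `2` exceeds the kernel support and leaves room for dilations by a random bandwidth.
  eq : ∀ᶠ a in 𝓝[>] (0 : ℝ), ∀ b u, |u| ≤ 2 → armProb p b (t + a * u) = r b u

/-- Bounded measurable functions supported on `[-2, 2]`. -/
structure IsTestFun (g : ℝ → ℝ) : Prop where
  meas : Measurable g
  bdd : ∃ B, 0 ≤ B ∧ ∀ u, |g u| ≤ B
  supp : ∀ u, 2 < |u| → g u = 0

lemma IsWindow.isTestFun {g : ℝ → ℝ} (hg : IsWindow g) : IsTestFun g :=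
  ⟨hg.measurable, hg.bounded, fun u hu => hg.supp u (by linarith)⟩

lemma IsTestFun.sq {g : ℝ → ℝ} (hg : IsTestFun g) : IsTestFun (fun u => g u ^ 2) := by
  obtain ⟨B, hB, hgB⟩ := hg.bdd
  refine ⟨hg.meas.pow_const 2, ⟨B ^ 2, sq_nonneg B, fun u => ?_⟩, fun u hu => by
    rw [hg.supp u hu]; simp⟩
  rw [abs_pow]
  exact pow_le_pow_left₀ (abs_nonneg _) (hgB u) 2

/-- The kernel estimate `a⁻¹ E[g((X - t) / a); arm]` converges as `a → 0`. -/
lemma tendsto_scaled_integral {p f : ℝ → ℝ} {t : ℝ} {r : Bool → ℝ → ℝ}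
    (hr : HasLocalShape p t r) (hfm : Measurable f) (hf0 : ∀ x, 0 ≤ f x) (hf : ContinuousAt f t)
    {g : ℝ → ℝ} (hg : IsTestFun g) (b : Bool) :
    Tendsto (fun a => a⁻¹ * ∫ x, f x * (armProb p b x * g ((x - t) / a))) (𝓝[>] 0)
      (𝓝 (f t * ∫ u, g u * r b u)) := by
  obtain ⟨B, hB, hgB⟩ := hg.bdd
  -- Substitution `x = t + a u`; dominated convergence then needs `f` to be bounded only near `t`.
  have hsub : ∀ a : ℝ, 0 < a → a⁻¹ * ∫ x, f x * (armProb p b x * g ((x - t) / a)) =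
      ∫ u, f (t + a * u) * (armProb p b (t + a * u) * g u) := by
    intro a ha
    have h1 := Measure.integral_comp_mul_left
      (fun v => f (t + v) * (armProb p b (t + v) * g (v / a))) a
    have h2 := integral_add_left_eq_self (μ := volume)
      (fun x => f x * (armProb p b x * g ((x - t) / a))) t
    simp only [add_sub_cancel_left] at h2
    rw [h2, abs_of_pos (inv_pos.2 ha), smul_eq_mul] at h1
    rw [← h1]
    refine integral_congr_ae (Eventually.of_forall fun u => ?_)
    simp only [mul_div_cancel_left₀ u ha.ne']
  have hlim : Tendsto (fun a : ℝ => ∫ u, f (t + a * u) * (r b u * g u)) (𝓝[>] 0)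
      (𝓝 (∫ u, f t * (r b u * g u))) := by
    obtain ⟨η, hη, hfη⟩ := Metric.eventually_nhds_iff.1
      (hf.eventually (gt_mem_nhds (lt_add_one (f t))))
    refine tendsto_integral_filter_of_dominated_convergence
      (fun u => (Set.Icc (-2 : ℝ) 2).indicator (fun _ => (f t + 1) * B) u) ?_ ?_ ?_ ?_
    · exact Eventually.of_forall fun a => ((hfm.comp (by fun_prop)).mul
        ((hr.meas b).mul hg.meas)).aestronglyMeasurable
    · have hsmall : ∀ᶠ a in 𝓝[>] (0 : ℝ), a < η / 2 :=
        mem_nhdsWithin_of_mem_nhds (gt_mem_nhds (by positivity))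
      filter_upwards [hsmall, self_mem_nhdsWithin] with a ha ha0
      have ha0 : 0 < a := ha0
      refine Eventually.of_forall fun u => ?_
      by_cases hu : u ∈ Set.Icc (-2 : ℝ) 2
      · rw [Set.indicator_of_mem hu, norm_mul, norm_mul, Real.norm_eq_abs, Real.norm_eq_abs,
          Real.norm_eq_abs, abs_of_nonneg (hf0 _), abs_of_nonneg (hr.nonneg b u)]
        have hfle : f (t + a * u) ≤ f t + 1 := by
          refine (hfη ?_).le
          rw [Real.dist_eq, add_sub_cancel_left, abs_mul, abs_of_pos ha0]
          have : |u| ≤ 2 := abs_le.2 hu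
          nlinarith [abs_nonneg u]
        have : r b u * |g u| ≤ B := by
          calc r b u * |g u| ≤ 1 * |g u| :=
                mul_le_mul_of_nonneg_right (hr.le_one b u) (abs_nonneg _)
            _ ≤ B := by rw [one_mul]; exact hgB u
        exact mul_le_mul hfle this (mul_nonneg (hr.nonneg b u) (abs_nonneg _))
          (by linarith [hf0 t])
      · rw [Set.indicator_of_notMem hu, hg.supp u (not_le.1 fun h => hu (abs_le.1 h))]
        simp
    · exact (integrable_indicator_iff measurableSet_Icc).2 (integrableOn_const (by simp))
    · refine Eventually.of_forall fun u => ?_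
      have hc : Tendsto (fun a : ℝ => t + a * u) (𝓝[>] 0) (𝓝 t) := by
        have : Tendsto (fun a : ℝ => t + a * u) (𝓝 0) (𝓝 (t + 0 * u)) :=
          (by fun_prop : Continuous fun a : ℝ => t + a * u).tendsto 0
        simp only [zero_mul, add_zero] at this
        exact this.mono_left nhdsWithin_le_nhds
      exact (hf.tendsto.comp hc).mul_const _
  rw [integral_const_mul] at hlim
  simp only [mul_comm (g _)]
  refine hlim.congr' ?_
  filter_upwards [hr.eq, self_mem_nhdsWithin] with a ha ha0
  rw [hsub a ha0]
  refine integral_congr_ae (Eventually.of_forall fun u => ?_)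
  by_cases hu : |u| ≤ 2
  · simp only [ha b u hu]
  · simp only [hg.supp u (not_le.1 hu), mul_zero]

/-! ### Kernel sums at a deterministic bandwidth -/

section ArmSum

variable {Ω : Type*} [MeasurableSpace Ω]

/-- The sum of `g ((X i - t) / a)` over the subjects `i < N` in an arm. -/
noncomputable def armSum (W : ℕ → Ω → ℝ × ℝ × ℝ) (Z : ℕ → Ω → ℝ) (t : ℝ) (b : Bool)
    (g : ℝ → ℝ) (a : ℝ) (N : ℕ) (ω : Ω) : ℝ :=
  ∑ i : Fin N, g (((W i ω).1 - t) / a) * armIndicator b (Z i ω)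

lemma armIndicator_nonneg (b : Bool) (z : ℝ) : 0 ≤ armIndicator b z := by
  unfold armIndicator; split_ifs <;> norm_num

lemma armIndicator_sq (b : Bool) (z : ℝ) : armIndicator b z ^ 2 = armIndicator b z := by
  unfold armIndicator; split_ifs <;> norm_num

lemma armIndicator_le_one (b : Bool) (z : ℝ) : armIndicator b z ≤ 1 := by
  unfold armIndicator; split_ifs <;> norm_num

lemma measurable_armIndicator (b : Bool) : Measurable (armIndicator b) := by
  have h1 : MeasurableSet {z : ℝ | z = 1} := measurableSet_singleton _
  refine Measurable.ite ?_ measurable_const measurable_const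
  cases b
  · convert h1.compl using 1
    ext z
    simp
  · simp

variable {P : Measure Ω} [IsProbabilityMeasure P] {D : Measure (ℝ × ℝ × ℝ)}
  {p f : ℝ → ℝ} {t : ℝ} {r : Bool → ℝ → ℝ} {W : ℕ → Ω → ℝ × ℝ × ℝ} {Z : ℕ → Ω → ℝ}

namespace IsDesign

lemma integral_mul_armIndicator (h : IsDesign P D p W Z) (hfm : Measurable f)
    (hf0 : ∀ x, 0 ≤ f x)
    (hf : D.map (fun w => w.1) = volume.withDensity (fun x => ENNReal.ofReal (f x)))
    {g : ℝ → ℝ} (hg : Measurable g) (b : Bool) (i : ℕ) :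
    ∫ ω, g (W i ω).1 * armIndicator b (Z i ω) ∂P = ∫ x, f x * (armProb p b x * g x) := by
  have e1 : ∫ ω, g (W i ω).1 * armIndicator b (Z i ω) ∂P =
      ∫ ω in {ω | Z i ω = armValue b}, g (W i ω).1 ∂P := by
    rw [← integral_indicator (h.measurableSet_arm i b)]
    refine integral_congr_ae (Eventually.of_forall fun ω => ?_)
    have : ((-1 : ℝ) = 1) = False := by norm_num
    have h' : ((1 : ℝ) = -1) = False := by norm_num
    rcases h.values i ω with hz | hz <;> cases b <;>
      simp [Set.indicator, armIndicator, armValue, hz, this, h']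
  have hm : Measurable fun x => armProb p b x * g x := (h.measurable_armProb b).mul hg
  rw [e1, h.setIntegral_arm i b (g := fun w => g w.1) (hg.comp measurable_fst),
    ← integral_map (φ := fun w : ℝ × ℝ × ℝ => w.1) (f := fun x => armProb p b x * g x)
      measurable_fst.aemeasurable hm.aestronglyMeasurable, hf,
    integral_withDensity_eq_integral_toReal_smul hfm.ennreal_ofReal
      (Eventually.of_forall fun w => ENNReal.ofReal_lt_top)]
  refine integral_congr_ae (Eventually.of_forall fun w => ?_)
  simp [ENNReal.toReal_ofReal (hf0 w)]

/-- Weak law of large numbers for local averages, with a deterministic bandwidth. -/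
theorem tendsto_armSum (h : IsDesign P D p W Z) (hfm : Measurable f) (hf0 : ∀ x, 0 ≤ f x)
    (hf : D.map (fun w => w.1) = volume.withDensity (fun x => ENNReal.ofReal (f x)))
    (hft : ContinuousAt f t) (hr : HasLocalShape p t r) {g : ℝ → ℝ} (hg : IsTestFun g)
    (b : Bool) {a : ℕ → ℝ} (ha : Tendsto a atTop (𝓝[>] 0))
    (haN : Tendsto (fun N : ℕ => (N : ℝ) * a N) atTop atTop) :
    Tendsto (fun x : ℕ × Ω => (x.1 * a x.1)⁻¹ * armSum W Z t b g (a x.1) x.1 x.2)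
      (probFilter P) (𝓝 (f t * ∫ u, g u * r b u)) := by
  obtain ⟨B, hB, hgB⟩ := hg.bdd
  set ξ : ℕ → ℕ → Ω → ℝ := fun N i ω =>
    g (((W i ω).1 - t) / a N) * armIndicator b (Z i ω) with hξ
  have hga : ∀ N, Measurable fun x => g ((x - t) / a N) := fun N =>
    hg.meas.comp (by fun_prop)
  have hξm : ∀ N i, Measurable (ξ N i) := fun N i =>
    ((hga N).comp (h.iid.meas i).fst).mul ((measurable_armIndicator b).comp (h.meas i))
  have hξB : ∀ N i ω, |ξ N i ω| ≤ B := by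
    intro N i ω
    rw [hξ]
    simp only [abs_mul, abs_of_nonneg (armIndicator_nonneg b _)]
    calc _ ≤ B * 1 := mul_le_mul (hgB _) (armIndicator_le_one b _) (armIndicator_nonneg b _) hB
      _ = B := mul_one B
  have hξL : ∀ N i, MemLp (ξ N i) 2 P := fun N i =>
    MemLp.of_bound (hξm N i).aestronglyMeasurable B (Eventually.of_forall (hξB N i))
  have hmean : ∀ N i, ∫ ω, ξ N i ω ∂P = ∫ x, f x * (armProb p b x * g ((x - t) / a N)) :=
    fun N i => h.integral_mul_armIndicator hfm hf0 hf (hga N) b i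
  have hsq : ∀ N i, ∫ ω, ξ N i ω ^ 2 ∂P =
      ∫ x, f x * (armProb p b x * g ((x - t) / a N) ^ 2) := by
    intro N i
    rw [← h.integral_mul_armIndicator hfm hf0 hf ((hga N).pow_const 2) b i]
    simp only [hξ, mul_pow, armIndicator_sq]
  have hindep : ∀ N, iIndepFun (fun i => ξ N i) P := fun N =>
    h.indep.comp (fun _ q => g ((q.1.1 - t) / a N) * armIndicator b q.2) fun _ =>
      ((hga N).comp measurable_fst.fst).mul ((measurable_armIndicator b).comp measurable_snd)
  set S : ℕ → Ω → ℝ := fun N ω => ∑ i : Fin N, ξ N i ω with hS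
  have hSL : ∀ N, MemLp (S N) 2 P := fun N => memLp_finsetSum _ fun i _ => hξL N i
  have hSmean : ∀ N, ∫ ω, S N ω ∂P = N * ∫ x, f x * (armProb p b x * g ((x - t) / a N)) := by
    intro N
    have := integral_finsetSum (μ := P) Finset.univ (f := fun (i : Fin N) => ξ N i)
      fun i _ => (hξL N i).integrable one_le_two
    simp only [hmean, Finset.sum_const, Finset.card_univ, Fintype.card_fin, nsmul_eq_mul] at this
    exact this
  have hSvar : ∀ N, Var[S N; P] ≤ N * ∫ x, f x * (armProb p b x * g ((x - t) / a N) ^ 2) := by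
    intro N
    have e : S N = ∑ i : Fin N, ξ N i := by ext ω; simp [hS]
    rw [e, IndepFun.variance_sum (X := fun i : Fin N => ξ N i) (fun i _ => hξL N i)
      (fun i _ j _ hij => (hindep N).indepFun (fun hv => hij (Fin.ext hv)))]
    calc _ ≤ ∑ i : Fin N, ∫ ω, ξ N i ω ^ 2 ∂P :=
          Finset.sum_le_sum fun i _ => variance_le_expectation_sq (hξm N i).aestronglyMeasurable
      _ = _ := by simp [hsq]
  have hM := (tendsto_scaled_integral hr hfm hf0 hft hg b).comp ha
  have hM2 := (tendsto_scaled_integral hr hfm hf0 hft hg.sq b).comp ha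
  -- The bound on the variance of the normalized sum is `1 / (N a)` times a kernel average of `g ^
  -- 2`; the average converges and `N a → ∞`, so Chebyshev applies.
  have hv0 : Tendsto (fun N : ℕ => ((N : ℝ) * a N)⁻¹ *
      ((a N)⁻¹ * ∫ x, f x * (armProb p b x * g ((x - t) / a N) ^ 2))) atTop (𝓝 0) := by
    have := (tendsto_inv_atTop_zero.comp haN).mul hM2
    rw [zero_mul] at this
    exact this
  have hpos : ∀ᶠ N : ℕ in atTop, 0 < (N : ℝ) * a N := haN.eventually_gt_atTop 0
  have hdev : Tendsto (fun x : ℕ × Ω => (x.1 * a x.1)⁻¹ * (S x.1 x.2 - ∫ ω, S x.1 ω ∂P))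
      (probFilter P) (𝓝 0) := by
    rw [Metric.tendsto_nhds]
    intro ε hε
    rw [eventually_probFilter_iff]
    have hlim : Tendsto (fun N : ℕ => ENNReal.ofReal ((((N : ℝ) * a N)⁻¹ *
      ((a N)⁻¹ * ∫ x, f x * (armProb p b x * g ((x - t) / a N) ^ 2))) / ε ^ 2)) atTop (𝓝 0) := by
      have := ENNReal.tendsto_ofReal (hv0.div_const (ε ^ 2))
      simpa using this
    refine tendsto_of_tendsto_of_tendsto_of_le_of_le' tendsto_const_nhds hlim
      (Eventually.of_forall fun _ => zero_le) ?_
    filter_upwards [hpos, ha.eventually self_mem_nhdsWithin] with N hN haN0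
    have haN0 : 0 < a N := haN0
    have hset : {ω | ¬ dist (((N : ℝ) * a N)⁻¹ * (S N ω - ∫ ω, S N ω ∂P)) 0 < ε} ⊆
        {ω | N * a N * ε ≤ |S N ω - ∫ ω, S N ω ∂P|} := by
      intro ω hω
      have hω' : ε ≤ |((N : ℝ) * a N)⁻¹ * (S N ω - ∫ ω, S N ω ∂P)| := by
        have := not_lt.1 hω
        rwa [dist_zero_right, Real.norm_eq_abs] at this
      rw [abs_mul, abs_of_pos (inv_pos.2 hN), inv_mul_eq_div, le_div_iff₀ hN] at hω'
      change N * a N * ε ≤ |S N ω - ∫ ω, S N ω ∂P|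
      linarith
    refine (measure_mono hset).trans ((meas_ge_le_variance_div_sq (hSL N)
      (by positivity)).trans (ENNReal.ofReal_le_ofReal ?_))
    calc Var[S N; P] / (N * a N * ε) ^ 2
        ≤ (N * ∫ x, f x * (armProb p b x * g ((x - t) / a N) ^ 2)) / (N * a N * ε) ^ 2 := by
          gcongr; exact hSvar N
      _ = _ := by
          have : (N : ℝ) ≠ 0 := fun h0 => by simp [h0] at hN
          field_simp
  have hmain := hdev.add ((hM.comp (tendsto_fst_probFilter P)))
  rw [zero_add] at hmain
  refine hmain.congr' ?_
  filter_upwards [(tendsto_fst_probFilter P).eventually hpos] with x hx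
  have hN : (x.1 : ℝ) ≠ 0 := left_ne_zero_of_mul hx.ne'
  have ha0 : a x.1 ≠ 0 := right_ne_zero_of_mul hx.ne'
  rw [hSmean]
  simp only [Function.comp, armSum, hS, hξ]
  field_simp
  ring

end IsDesign

end ArmSum

/-! ### From deterministic to random bandwidths -/

/-- Small dilations change a window little in mean. -/
lemma IsWindow.exists_dilation_bound {g : ℝ → ℝ} (hg : IsWindow g) {η : ℝ} (hη : 0 < η) :
    ∃ ε > 0, ∃ w : ℝ → ℝ, IsTestFun w ∧ (∀ u, 0 ≤ w u) ∧ Integrable w ∧ ∫ u, w u ≤ η ∧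
      ∀ σ u, |σ - 1| ≤ ε → |g (σ * u) - g u| ≤ w u := by
  obtain ⟨B, hB, hgB⟩ := hg.bounded
  obtain ⟨ε₁, hε₁, huc⟩ := Metric.uniformContinuousOn_iff.1
    (isCompact_Icc.uniformContinuousOn_of_continuous hg.cont) (η / 4) (by positivity)
  -- Inside the window uniform continuity gives `η / 4`. Near `±1`, where `g` may jump, only the
  -- crude bound `2 * B` holds, on two intervals of length `3 * ε`; the third term of the minimum
  -- makes their total mass at most `η / 2`. The bound `1 / 2` ensures `(1 - ε) * (1 + 2 * ε) ≥ 1`,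
  -- so that beyond `1 + 2 * ε` both values are zero.
  set ε := min (ε₁ / 2) (min (1 / 2) (η / (24 * (B + 1)))) with hε
  have hεpos : 0 < ε := lt_min (by positivity) (lt_min (by norm_num) (by positivity))
  have hε1 : ε ≤ ε₁ / 2 := min_le_left _ _
  have hε2 : ε ≤ 1 / 2 := (min_le_right _ _).trans (min_le_left _ _)
  have hε3 : ε ≤ η / (24 * (B + 1)) := (min_le_right _ _).trans (min_le_right _ _)
  set w1 := (Set.Icc (-1 : ℝ) 1).indicator fun _ => η / 4 with hw1
  set w2 := (Set.Icc (1 - ε) (1 + 2 * ε)).indicator fun _ => 2 * B with hw2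
  set w3 := (Set.Icc (-(1 + 2 * ε)) (-(1 - ε))).indicator fun _ => 2 * B with hw3
  have n1 : ∀ u, 0 ≤ w1 u := fun u => Set.indicator_nonneg (fun _ _ => by positivity) u
  have n2 : ∀ u, 0 ≤ w2 u := fun u => Set.indicator_nonneg (fun _ _ => by positivity) u
  have n3 : ∀ u, 0 ≤ w3 u := fun u => Set.indicator_nonneg (fun _ _ => by positivity) u
  have m1 : Measurable w1 := measurable_const.indicator measurableSet_Icc
  have m2 : Measurable w2 := measurable_const.indicator measurableSet_Icc
  have m3 : Measurable w3 := measurable_const.indicator measurableSet_Icc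
  have b1 : ∀ u, w1 u ≤ η / 4 := fun u => Set.indicator_le_self' (fun _ _ => by positivity) u
  have b2 : ∀ u, w2 u ≤ 2 * B := fun u => Set.indicator_le_self' (fun _ _ => by positivity) u
  have b3 : ∀ u, w3 u ≤ 2 * B := fun u => Set.indicator_le_self' (fun _ _ => by positivity) u
  have i1 : Integrable w1 :=
    (integrable_indicator_iff measurableSet_Icc).2 (integrableOn_const (by simp))
  have i2 : Integrable w2 :=
    (integrable_indicator_iff measurableSet_Icc).2 (integrableOn_const (by simp))
  have i3 : Integrable w3 :=
    (integrable_indicator_iff measurableSet_Icc).2 (integrableOn_const (by simp))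
  have e1 : ∫ u, w1 u = η / 2 := by
    rw [hw1, integral_indicator_const _ measurableSet_Icc, Real.volume_real_Icc]
    norm_num
    ring
  have e2 : ∫ u, w2 u = 6 * B * ε := by
    rw [hw2, integral_indicator_const _ measurableSet_Icc, Real.volume_real_Icc,
      max_eq_left (by linarith), smul_eq_mul]
    ring
  have e3 : ∫ u, w3 u = 6 * B * ε := by
    rw [hw3, integral_indicator_const _ measurableSet_Icc, Real.volume_real_Icc,
      max_eq_left (by linarith), smul_eq_mul]
    ring
  refine ⟨ε, hεpos, fun u => w1 u + w2 u + w3 u, ⟨(m1.add m2).add m3,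
    ⟨η / 4 + 2 * B + 2 * B, by positivity, fun u => ?_⟩, fun u hu => ?_⟩,
    fun u => add_nonneg (add_nonneg (n1 u) (n2 u)) (n3 u), (i1.add i2).add i3, ?_,
    fun σ u hσ => ?_⟩
  · rw [abs_of_nonneg (add_nonneg (add_nonneg (n1 u) (n2 u)) (n3 u))]
    exact add_le_add (add_le_add (b1 u) (b2 u)) (b3 u)
  · have hu' : u < -2 ∨ 2 < u := (lt_abs.1 hu).symm.imp_left fun h => by linarith
    rw [hw1, hw2, hw3, Set.indicator_of_notMem, Set.indicator_of_notMem,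
      Set.indicator_of_notMem]
    · ring
    all_goals
      rintro ⟨h1, h2⟩
      rcases hu' with h | h <;> linarith
  · have hi12 : Integrable fun u => w1 u + w2 u := i1.add i2
    rw [integral_add hi12 i3, integral_add i1 i2, e1, e2, e3]
    have : 12 * B * ε ≤ η / 2 := by
      calc 12 * B * ε ≤ 12 * (B + 1) * (η / (24 * (B + 1))) :=
            mul_le_mul (by linarith) hε3 hεpos.le (by positivity)
        _ = η / 2 := by field_simp; norm_num
    linarith
  · have hσ' := abs_le.1 hσ
    rcases lt_trichotomy (1 + 2 * ε) |u| with h | h | h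
    · have hσu : 1 < |σ * u| := by
        rw [abs_mul, abs_of_pos (by linarith : 0 < σ)]
        have : (1 - ε) * (1 + 2 * ε) ≥ 1 := by nlinarith
        nlinarith [abs_nonneg u]
      rw [hg.supp _ hσu, hg.supp u (by linarith), sub_self, abs_zero]
      exact add_nonneg (add_nonneg (n1 u) (n2 u)) (n3 u)
    all_goals
      by_cases hlt : |u| < 1 - ε
      · have hu := abs_lt.1 hlt
        have hσu : |σ * u| ≤ 1 := by
          rw [abs_mul, abs_of_pos (by linarith : 0 < σ)]
          nlinarith [abs_nonneg u]
        have hmem : u ∈ Set.Icc (-1 : ℝ) 1 := ⟨by linarith, by linarith⟩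
        have hd := huc (σ * u) (abs_le.1 hσu) u hmem (by
          rw [Real.dist_eq, show σ * u - u = (σ - 1) * u by ring, abs_mul]
          nlinarith [abs_nonneg u, abs_nonneg (σ - 1)])
        rw [Real.dist_eq] at hd
        have : w1 u = η / 4 := Set.indicator_of_mem hmem _
        linarith [n2 u, n3 u]
      · have hd : |g (σ * u) - g u| ≤ 2 * B :=
          (abs_sub _ _).trans (by linarith [hgB (σ * u), hgB u])
        rcases abs_choice u with hu | hu
        · have : w2 u = 2 * B := Set.indicator_of_mem
            (Set.mem_Icc.2 ⟨by linarith, by linarith⟩ : u ∈ Set.Icc (1 - ε) (1 + 2 * ε)) _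
          linarith [n1 u, n3 u]
        · have : w3 u = 2 * B := Set.indicator_of_mem
            (Set.mem_Icc.2 ⟨by linarith, by linarith⟩ : u ∈ Set.Icc (-(1 + 2 * ε)) (-(1 - ε))) _
          linarith [n1 u, n2 u]

section RandomBandwidth

variable {Ω : Type*} [MeasurableSpace Ω] {P : Measure Ω} {D : Measure (ℝ × ℝ × ℝ)}
  {p f : ℝ → ℝ} {t : ℝ} {r : Bool → ℝ → ℝ} {W : ℕ → Ω → ℝ × ℝ × ℝ} {Z : ℕ → Ω → ℝ}

/-- Weak law of large numbers for local averages, with a random bandwidth. -/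
theorem IsDesign.tendsto_armSum_random [IsProbabilityMeasure P] (h : IsDesign P D p W Z)
    (hfm : Measurable f) (hf0 : ∀ x, 0 ≤ f x)
    (hf : D.map (fun w => w.1) = volume.withDensity (fun x => ENNReal.ofReal (f x)))
    (hft : ContinuousAt f t) (hr : HasLocalShape p t r) {g : ℝ → ℝ} (hg : IsWindow g)
    (b : Bool) {a : ℕ → ℝ} (ha : Tendsto a atTop (𝓝[>] 0))
    (haN : Tendsto (fun N : ℕ => (N : ℝ) * a N) atTop atTop) {s : ℕ × Ω → ℝ}
    (hs : Tendsto s (probFilter P) (𝓝 1)) :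
    Tendsto (fun x : ℕ × Ω => (x.1 * a x.1)⁻¹ * armSum W Z t b g (a x.1 * s x) x.1 x.2)
      (probFilter P) (𝓝 (f t * ∫ u, g u * r b u)) := by
  rw [Metric.tendsto_nhds]
  intro ε hε
  have hft0 := hf0 t
  -- The `+ 1` guards against `f t = 0`, which is not excluded here.
  obtain ⟨ε', hε', w, hwt, hw0, hwi, hwI, hw⟩ :=
    hg.exists_dilation_bound (η := ε / (4 * (f t + 1))) (by positivity)
  have hwr : f t * ∫ u, w u * r b u < ε / 2 := by
    have h1 : ∫ u, w u * r b u ≤ ∫ u, w u := by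
      refine integral_mono_of_nonneg (Eventually.of_forall fun u =>
        mul_nonneg (hw0 u) (hr.nonneg b u)) hwi (Eventually.of_forall fun u => ?_)
      exact mul_le_of_le_one_right (hw0 u) (hr.le_one b u)
    calc f t * ∫ u, w u * r b u ≤ (f t + 1) * (ε / (4 * (f t + 1))) :=
          mul_le_mul (by linarith) (h1.trans hwI)
            (integral_nonneg fun u => mul_nonneg (hw0 u) (hr.nonneg b u)) (by positivity)
      _ = ε / 4 := by field_simp
      _ < ε / 2 := by linarith
  have hG := h.tendsto_armSum hfm hf0 hf hft hr hg.isTestFun b ha haN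
  have hWs := h.tendsto_armSum hfm hf0 hf hft hr hwt b ha haN
  have hsinv : Tendsto (fun x => (s x)⁻¹) (probFilter P) (𝓝 1) := by
    simpa using hs.inv₀ one_ne_zero
  filter_upwards [Metric.tendsto_nhds.1 hG (ε / 2) (by positivity),
    hWs.eventually (gt_mem_nhds hwr), Metric.tendsto_nhds.1 hsinv ε' hε',
    (tendsto_fst_probFilter P).eventually (haN.eventually_gt_atTop 0)] with x hx1 hx2 hx3 hx4
  -- Changing the bandwidth by `s` dilates the argument by `s⁻¹`. The majorant `w` is independent of
  -- `s`, so its sum has a deterministic bandwidth and obeys the previous law of large numbers.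
  have hdiff : |armSum W Z t b g (a x.1 * s x) x.1 x.2 - armSum W Z t b g (a x.1) x.1 x.2| ≤
      armSum W Z t b w (a x.1) x.1 x.2 := by
    simp only [armSum]
    rw [← Finset.sum_sub_distrib]
    refine (Finset.abs_sum_le_sum_abs _ _).trans (Finset.sum_le_sum fun i _ => ?_)
    rw [← sub_mul, abs_mul, abs_of_nonneg (armIndicator_nonneg b _)]
    refine mul_le_mul_of_nonneg_right ?_ (armIndicator_nonneg b _)
    have e : ((W i x.2).1 - t) / (a x.1 * s x) = (s x)⁻¹ * (((W i x.2).1 - t) / a x.1) := by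
      rw [mul_comm (a x.1), div_mul_eq_div_div, div_right_comm, inv_mul_eq_div]
    rw [e]
    exact hw _ _ hx3.le
  have hinv : 0 < ((x.1 : ℝ) * a x.1)⁻¹ := inv_pos.2 hx4
  have hdiff' := mul_le_mul_of_nonneg_left hdiff hinv.le
  rw [← abs_of_pos hinv, ← abs_mul, abs_of_pos hinv, mul_sub] at hdiff'
  rw [Real.dist_eq, abs_sub_lt_iff] at hx1 ⊢
  have := abs_le.1 hdiff'
  constructor <;> linarith [this.1, this.2, hx1.1, hx1.2]

end RandomBandwidth

/-! ### Asymptotics of a weighted local linear fit -/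

section FitLimits

variable {α : Type*} {F : Filter α} {ι : α → Type*} [∀ x, Fintype (ι x)]
  {A u : ∀ x, ι x → ℝ} {n : α → ℝ} {S T : ℕ → ℝ}

/-- The limit of the second moment of the weights. -/
noncomputable def biasConst (S : ℕ → ℝ) : ℝ := (S 2 ^ 2 - S 1 * S 3) / (S 0 * S 2 - S 1 ^ 2)

/-- The limit of the normalized sum of the squared weights. -/
noncomputable def varConst (S T : ℕ → ℝ) : ℝ :=
  (S 2 ^ 2 * T 0 - 2 * S 1 * S 2 * T 1 + S 1 ^ 2 * T 2) / (S 0 * S 2 - S 1 ^ 2) ^ 2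

lemma tendsto_fitDet (hS : ∀ j, Tendsto (fun x => (n x)⁻¹ * powerSum (A x) (u x) j) F (𝓝 (S j))) :
    Tendsto (fun x => (n x)⁻¹ ^ 2 * fitDet (A x) (u x)) F (𝓝 (S 0 * S 2 - S 1 ^ 2)) := by
  refine (((hS 0).mul (hS 2)).sub ((hS 1).pow 2)).congr fun x => ?_
  rw [fitDet]; ring

lemma eventually_fitDet_ne_zero
    (hS : ∀ j, Tendsto (fun x => (n x)⁻¹ * powerSum (A x) (u x) j) F (𝓝 (S j)))
    (hd : S 0 * S 2 - S 1 ^ 2 ≠ 0) : ∀ᶠ x in F, fitDet (A x) (u x) ≠ 0 := by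
  filter_upwards [(tendsto_fitDet hS).eventually_ne hd] with x hx h0
  simp [h0] at hx

lemma tendsto_sum_fitWeight_mul_sq
    (hS : ∀ j, Tendsto (fun x => (n x)⁻¹ * powerSum (A x) (u x) j) F (𝓝 (S j)))
    (hn : ∀ᶠ x in F, 0 < n x) (hd : S 0 * S 2 - S 1 ^ 2 ≠ 0) :
    Tendsto (fun x => ∑ i, fitWeight (A x) (u x) i * u x i ^ 2) F (𝓝 (biasConst S)) := by
  refine ((((hS 2).pow 2).sub ((hS 1).mul (hS 3))).div (tendsto_fitDet hS) hd).congr' ?_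
  filter_upwards [hn] with x hx
  rw [sum_fitWeight_mul_pow]
  simp only [Pi.div_apply]
  have : (n x)⁻¹ ^ 2 ≠ 0 := by positivity
  refine Eq.trans ?_ (mul_div_mul_left _ _ this)
  congr 1
  ring

lemma tendsto_sum_fitWeight_sq
    (hS : ∀ j, Tendsto (fun x => (n x)⁻¹ * powerSum (A x) (u x) j) F (𝓝 (S j)))
    (hT : ∀ j, Tendsto (fun x => (n x)⁻¹ * powerSum (fun i => A x i ^ 2) (u x) j) F (𝓝 (T j)))
    (hn : ∀ᶠ x in F, 0 < n x) (hd : S 0 * S 2 - S 1 ^ 2 ≠ 0) :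
    Tendsto (fun x => n x * ∑ i, fitWeight (A x) (u x) i ^ 2) F (𝓝 (varConst S T)) := by
  refine ((((((hS 2).pow 2).mul (hT 0)).sub ((((hS 1).const_mul 2).mul (hS 2)).mul (hT 1))).add
    (((hS 1).pow 2).mul (hT 2))).div ((tendsto_fitDet hS).pow 2) (pow_ne_zero 2 hd)).congr' ?_
  filter_upwards [hn] with x hx
  rw [sum_fitWeight_sq, ← mul_div_assoc]
  simp only [Pi.div_apply]
  have : (n x)⁻¹ ^ 4 ≠ 0 := by positivity
  refine Eq.trans ?_ (mul_div_mul_left _ _ this)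
  congr 1
  · field_simp
  · ring

lemma eventually_sum_abs_fitWeight_le
    (hS : ∀ j, Tendsto (fun x => (n x)⁻¹ * powerSum (A x) (u x) j) F (𝓝 (S j)))
    (hn : ∀ᶠ x in F, 0 < n x) (hd : S 0 * S 2 - S 1 ^ 2 ≠ 0) (hA : ∀ x i, 0 ≤ A x i)
    (hu : ∀ x i, A x i ≠ 0 → |u x i| ≤ 1) :
    ∃ C > 0, ∀ᶠ x in F, ∑ i, |fitWeight (A x) (u x) i| ≤ C := by
  have hlim := ((hS 0).mul ((hS 2).abs.add (hS 1).abs)).div (tendsto_fitDet hS).abs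
    (abs_ne_zero.2 hd)
  set L := S 0 * (|S 2| + |S 1|) / |S 0 * S 2 - S 1 ^ 2|
  refine ⟨|L| + 1, by positivity, ?_⟩
  filter_upwards [hlim.eventually (gt_mem_nhds (lt_of_le_of_lt (le_abs_self L)
    (lt_add_one _))), hn] with x hx hnx
  refine (sum_abs_fitWeight_le (hA x) (hu x)).trans (le_trans (le_of_eq ?_) hx.le)
  have h2 : (0 : ℝ) < (n x)⁻¹ ^ 2 := by positivity
  have h1 : (0 : ℝ) < (n x)⁻¹ := by positivity
  simp only [Pi.div_apply, abs_mul, abs_of_pos h1, abs_of_pos h2]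
  rw [← mul_div_mul_left _ _ h2.ne']
  congr 1
  ring

/-- The bias of the intercept of a local linear fit of a twice differentiable function. -/
lemma tendsto_fit_bias
    (hS : ∀ j, Tendsto (fun x => (n x)⁻¹ * powerSum (A x) (u x) j) F (𝓝 (S j)))
    (hn : ∀ᶠ x in F, 0 < n x) (hd : S 0 * S 2 - S 1 ^ 2 ≠ 0) (hA : ∀ x i, 0 ≤ A x i)
    (hu : ∀ x i, A x i ≠ 0 → |u x i| ≤ 1) {h : α → ℝ} (hh : Tendsto h F (𝓝[>] 0))
    {μ : ℝ → ℝ} {t m₁ m₂ : ℝ}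
    (hμ : (fun y => μ (t + y) - (μ t + m₁ * y + m₂ / 2 * y ^ 2)) =o[𝓝 0] fun y => y ^ 2) :
    Tendsto (fun x => (h x ^ 2)⁻¹ *
      (∑ i, fitWeight (A x) (u x) i * μ (t + h x * u x i) - μ t)) F
      (𝓝 (m₂ / 2 * biasConst S)) := by
  obtain ⟨C, hC, hCev⟩ := eventually_sum_abs_fitWeight_le hS hn hd hA hu
  have hmain := (tendsto_sum_fitWeight_mul_sq hS hn hd).const_mul (m₂ / 2)
  have hrem : Tendsto (fun x => (h x ^ 2)⁻¹ *
      (∑ i, fitWeight (A x) (u x) i * μ (t + h x * u x i) - μ t) -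
      m₂ / 2 * ∑ i, fitWeight (A x) (u x) i * u x i ^ 2) F (𝓝 0) := by
    rw [Metric.tendsto_nhds]
    intro ε hε
    have ho := hμ.def (c := ε / (2 * C)) (by positivity)
    obtain ⟨η, hη, hoη⟩ := Metric.eventually_nhds_iff.1 ho
    have hh0 : ∀ᶠ x in F, h x < η :=
      (hh.mono_right nhdsWithin_le_nhds).eventually (gt_mem_nhds hη)
    filter_upwards [hCev, hh0, hh.eventually self_mem_nhdsWithin,
      eventually_fitDet_ne_zero hS hd] with x hx1 hx2 hx3 hx4
    have hx3 : 0 < h x := hx3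
    set w := fitWeight (A x) (u x) with hw
    set R : ι x → ℝ := fun i => μ (t + h x * u x i) -
      (μ t + m₁ * (h x * u x i) + m₂ / 2 * (h x * u x i) ^ 2) with hR
    -- Exactness on affine functions removes the constant and linear Taylor terms.
    have hsum : ∑ i, w i * μ (t + h x * u x i) - μ t =
        h x ^ 2 * (m₂ / 2 * ∑ i, w i * u x i ^ 2) + ∑ i, w i * R i := by
      have h1 := sum_fitWeight (a := A x) (u := u x) hx4
      have h2 := sum_fitWeight_mul_self (A x) (u x)
      have h3 : ∑ i, w i * μ (t + h x * u x i) = μ t * ∑ i, w i + m₁ * h x * ∑ i, w i * u x i +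
          h x ^ 2 * (m₂ / 2) * ∑ i, w i * u x i ^ 2 + ∑ i, w i * R i := by
        simp only [Finset.mul_sum, ← Finset.sum_add_distrib]
        refine Finset.sum_congr rfl fun i _ => ?_
        rw [hR]; ring
      rw [h3, h1, h2]; ring
    have hRle : |∑ i, w i * R i| ≤ ε / 2 * h x ^ 2 := by
      calc |∑ i, w i * R i| ≤ ∑ i, |w i| * (ε / (2 * C) * h x ^ 2) := by
            refine (Finset.abs_sum_le_sum_abs _ _).trans (Finset.sum_le_sum fun i _ => ?_)
            rw [abs_mul]
            -- The Taylor bound is available only inside the kernel window; outside it the weight is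
            -- zero.
            by_cases hAi : A x i = 0
            · have : w i = 0 := by simp [hw, fitWeight, hAi]
              simp [this]
            · refine mul_le_mul_of_nonneg_left ?_ (abs_nonneg _)
              have hui := hu x i hAi
              have habs : |h x * u x i| ≤ h x := by
                rw [abs_mul, abs_of_pos hx3]
                exact mul_le_of_le_one_right hx3.le hui
              have := hoη (y := h x * u x i) (by
                rw [dist_zero_right, Real.norm_eq_abs]; exact habs.trans_lt hx2)
              rw [Real.norm_eq_abs, Real.norm_eq_abs, abs_pow] at this
              exact this.trans (mul_le_mul_of_nonneg_left
                (pow_le_pow_left₀ (abs_nonneg _) habs 2) (by positivity))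
        _ = (∑ i, |w i|) * (ε / (2 * C) * h x ^ 2) := by rw [Finset.sum_mul]
        _ ≤ C * (ε / (2 * C) * h x ^ 2) := mul_le_mul_of_nonneg_right hx1 (by positivity)
        _ = ε / 2 * h x ^ 2 := by field_simp
    have hh2 : 0 < h x ^ 2 := by positivity
    rw [hsum, dist_zero_right, Real.norm_eq_abs,
      show (h x ^ 2)⁻¹ * (h x ^ 2 * (m₂ / 2 * ∑ i, w i * u x i ^ 2) + ∑ i, w i * R i) -
        m₂ / 2 * ∑ i, w i * u x i ^ 2 = (h x ^ 2)⁻¹ * ∑ i, w i * R i by field_simp; ring,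
      abs_mul, abs_of_pos (inv_pos.2 hh2), inv_mul_eq_div, div_lt_iff₀ hh2]
    nlinarith
  have := hrem.add hmain
  rw [zero_add] at this
  exact this.congr fun x => by ring

/-- The variance of the intercept of a local linear fit. -/
lemma tendsto_fit_variance
    (hS : ∀ j, Tendsto (fun x => (n x)⁻¹ * powerSum (A x) (u x) j) F (𝓝 (S j)))
    (hT : ∀ j, Tendsto (fun x => (n x)⁻¹ * powerSum (fun i => A x i ^ 2) (u x) j) F (𝓝 (T j)))
    (hn : ∀ᶠ x in F, 0 < n x) (hd : S 0 * S 2 - S 1 ^ 2 ≠ 0)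
    (hu : ∀ x i, A x i ≠ 0 → |u x i| ≤ 1) {h : α → ℝ} (hh : Tendsto h F (𝓝[>] 0))
    {v : ℝ → ℝ} {t : ℝ} (hv : ContinuousAt v t) :
    Tendsto (fun x => n x * ∑ i, fitWeight (A x) (u x) i ^ 2 * v (t + h x * u x i)) F
      (𝓝 (v t * varConst S T)) := by
  have hsq := tendsto_sum_fitWeight_sq hS hT hn hd
  have hmain := hsq.const_mul (v t)
  have hrem : Tendsto (fun x =>
      n x * ∑ i, fitWeight (A x) (u x) i ^ 2 * v (t + h x * u x i) -
      v t * (n x * ∑ i, fitWeight (A x) (u x) i ^ 2)) F (𝓝 0) := by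
    rw [Metric.tendsto_nhds]
    intro ε hε
    set C := |varConst S T| + 1 with hC
    have hC0 : 0 < C := by positivity
    obtain ⟨η, hη, hvη⟩ := Metric.continuousAt_iff.1 hv (ε / (2 * C)) (by positivity)
    have hh0 : ∀ᶠ x in F, h x < η :=
      (hh.mono_right nhdsWithin_le_nhds).eventually (gt_mem_nhds hη)
    filter_upwards [hsq.eventually (gt_mem_nhds (lt_of_le_of_lt (le_abs_self _) (lt_add_one _))),
      hh0, hh.eventually self_mem_nhdsWithin, hn] with x hx1 hx2 hx3 hx4
    have hx3 : 0 < h x := hx3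
    set w := fitWeight (A x) (u x) with hw
    have e : n x * ∑ i, w i ^ 2 * v (t + h x * u x i) - v t * (n x * ∑ i, w i ^ 2) =
        n x * ∑ i, w i ^ 2 * (v (t + h x * u x i) - v t) := by
      simp only [mul_sub, Finset.sum_sub_distrib, ← Finset.sum_mul]
      ring
    have hle : |∑ i, w i ^ 2 * (v (t + h x * u x i) - v t)| ≤
        (∑ i, w i ^ 2) * (ε / (2 * C)) := by
      rw [Finset.sum_mul]
      refine (Finset.abs_sum_le_sum_abs _ _).trans (Finset.sum_le_sum fun i _ => ?_)
      rw [abs_mul, abs_of_nonneg (sq_nonneg (w i))]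
      by_cases hAi : A x i = 0
      · have : w i = 0 := by simp [hw, fitWeight, hAi]
        simp [this]
      · refine mul_le_mul_of_nonneg_left ?_ (sq_nonneg _)
        have hui := hu x i hAi
        have habs : |h x * u x i| ≤ h x := by
          rw [abs_mul, abs_of_pos hx3]
          exact mul_le_of_le_one_right hx3.le hui
        have := hvη (x := t + h x * u x i) (by
          rw [Real.dist_eq, add_sub_cancel_left]; exact habs.trans_lt hx2)
        rw [Real.dist_eq] at this
        exact this.le
    rw [e, dist_zero_right, Real.norm_eq_abs, abs_mul, abs_of_pos hx4]
    calc n x * |∑ i, w i ^ 2 * (v (t + h x * u x i) - v t)|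
        ≤ n x * ((∑ i, w i ^ 2) * (ε / (2 * C))) := mul_le_mul_of_nonneg_left hle hx4.le
      _ = (n x * ∑ i, w i ^ 2) * (ε / (2 * C)) := by ring
      _ ≤ C * (ε / (2 * C)) := mul_le_mul_of_nonneg_right hx1.le (by positivity)
      _ = ε / 2 := by field_simp
      _ < ε := by linarith
  have := hrem.add hmain
  rw [zero_add] at this
  exact this.congr fun x => by ring

end FitLimits

/-- Second order Taylor expansion at a point. -/
lemma ContDiffAt.isLittleO_sq {μ : ℝ → ℝ} {t : ℝ} (hμ : ContDiffAt ℝ 2 μ t) :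
    (fun y => μ (t + y) - (μ t + deriv μ t * y + iteratedDeriv 2 μ t / 2 * y ^ 2))
      =o[𝓝 0] fun y => y ^ 2 := by
  obtain ⟨s, hs, hμs⟩ := hμ.contDiffOn (m := 2) le_rfl (by simp)
  obtain ⟨ε, hε, hball⟩ := Metric.mem_nhds_iff.1 (by simpa using hs : s ∈ 𝓝 t)
  -- On an open convex neighborhood the derivatives within the set are the ordinary ones.
  have hopen : IsOpen (Metric.ball t ε) := Metric.isOpen_ball
  have ht : t ∈ Metric.ball t ε := Metric.mem_ball_self hε
  have h := taylor_isLittleO (n := 2) (convex_ball t ε) ht (by exact_mod_cast hμs.mono hball)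
  rw [hopen.nhdsWithin_eq ht] at h
  have hlim : Tendsto (fun y : ℝ => t + y) (𝓝 0) (𝓝 t) := by
    simpa using (by fun_prop : Continuous fun y : ℝ => t + y).tendsto 0
  refine (h.comp_tendsto hlim).congr (fun y => ?_) fun y => by simp
  simp only [Function.comp, taylorWithinEval_succ, taylor_within_zero_eval,
    iteratedDerivWithin_of_isOpen hopen ht, add_sub_cancel_left, smul_eq_mul]
  norm_num
  ring

/-! ### Asymptotic mean squared error -/

lemma powerSum_armWeight {Ω : Type*} (K : ℝ → ℝ) (W : ℕ → Ω → ℝ × ℝ × ℝ)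
    (Z : ℕ → Ω → ℝ) (t a : ℝ) (b : Bool) (N : ℕ) (ω : Ω) (j : ℕ) :
    powerSum (armWeight K t a b (designOf W Z N ω).1 (designOf W Z N ω).2)
      (fun i => ((W i ω).1 - t) / a) j = armSum W Z t b (fun u => u ^ j * K u) a N ω := by
  refine Finset.sum_congr rfl fun i _ => ?_
  simp only [armWeight, designOf]
  ring

lemma powerSum_armWeight_sq {Ω : Type*} (K : ℝ → ℝ) (W : ℕ → Ω → ℝ × ℝ × ℝ)
    (Z : ℕ → Ω → ℝ) (t a : ℝ) (b : Bool) (N : ℕ) (ω : Ω) (j : ℕ) :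
    powerSum (fun i => armWeight K t a b (designOf W Z N ω).1 (designOf W Z N ω).2 i ^ 2)
      (fun i => ((W i ω).1 - t) / a) j = armSum W Z t b (fun u => u ^ j * K u ^ 2) a N ω := by
  refine Finset.sum_congr rfl fun i _ => ?_
  simp only [armWeight, designOf, mul_pow, armIndicator_sq]
  ring

section MSE

variable {Ω : Type*} [MeasurableSpace Ω] {P : Measure Ω} {D : Measure (ℝ × ℝ × ℝ)}
  {p f μp μm vp vm K : ℝ → ℝ} {t : ℝ} {r : Bool → ℝ → ℝ} {W : ℕ → Ω → ℝ × ℝ × ℝ}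
  {Z : ℕ → Ω → ℝ}

/-- The limits of the normalized weighted power sums in an arm. -/
noncomputable def armMoment (f K : ℝ → ℝ) (t : ℝ) (r : Bool → ℝ → ℝ) (b : Bool) (j : ℕ) : ℝ :=
  f t * ∫ u, (u ^ j * K u) * r b u

/-- The limits of the normalized power sums with squared weights in an arm. -/
noncomputable def armSqMoment (f K : ℝ → ℝ) (t : ℝ) (r : Bool → ℝ → ℝ) (b : Bool) (j : ℕ) : ℝ :=
  f t * ∫ u, (u ^ j * K u ^ 2) * r b u

/-- With a bandwidth asymptotic to `c N ^ (-1/5)`, the conditional mean squared error is of order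
`N ^ (-4/5)`. -/
theorem IsDesign.tendsto_condMSE [IsProbabilityMeasure P] [IsProbabilityMeasure D]
    (h : IsDesign P D p W Z) (hD : RegularAt D t f μp μm vp vm) (hr : HasLocalShape p t r)
    (hK : IsAdmissibleKernel K) {βhat : FitRule} (hβ : IsLocalLinearFit K t βhat)
    (hd : ∀ b, armMoment f K t r b 0 * armMoment f K t r b 2 - armMoment f K t r b 1 ^ 2 ≠ 0)
    {c : ℝ} (hc : 0 < c) {s : ℕ × Ω → ℝ} (hs : Tendsto s (probFilter P) (𝓝 1)) :
    Tendsto (fun x : ℕ × Ω => (x.1 : ℝ) ^ (4 / 5 : ℝ) *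
        condMSE P βhat t (μp t - μm t) W Z (c * (x.1 : ℝ) ^ (-(1 / 5) : ℝ) * s x) x.1 x.2)
      (probFilter P)
      (𝓝 (c ^ 4 * (iteratedDeriv 2 μp t / 2 * biasConst (armMoment f K t r true) -
          iteratedDeriv 2 μm t / 2 * biasConst (armMoment f K t r false)) ^ 2 +
        (vp t * varConst (armMoment f K t r true) (armSqMoment f K t r true) +
          vm t * varConst (armMoment f K t r false) (armSqMoment f K t r false)) / c)) := by
  have hft : ContinuousAt f t := hD.density_diff.self_of_nhds.continuousAt
  set a : ℕ → ℝ := fun N => c * (N : ℝ) ^ (-(1 / 5) : ℝ) with ha_def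
  -- Writing `N = y ^ 5` turns all fractional powers into integer ones.
  have hroot : ∀ N : ℕ, 0 < N → ∃ y : ℝ, 0 < y ∧ (N : ℝ) = y ^ 5 ∧ a N = c / y ∧
      (N : ℝ) ^ (4 / 5 : ℝ) = y ^ 4 ∧ (N : ℝ) ^ (1 / 5 : ℝ) = y := by
    intro N hN
    have hN' : (0 : ℝ) < N := Nat.cast_pos.2 hN
    refine ⟨(N : ℝ) ^ (1 / 5 : ℝ), by positivity, ?_, ?_, ?_, rfl⟩
    · rw [← Real.rpow_natCast, ← Real.rpow_mul hN'.le]; norm_num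
    · rw [ha_def]; simp only; rw [Real.rpow_neg hN'.le, ← div_eq_mul_inv]
    · rw [← Real.rpow_natCast, ← Real.rpow_mul hN'.le]; norm_num
  have ha : Tendsto a atTop (𝓝[>] 0) := by
    refine tendsto_nhdsWithin_iff.2 ⟨?_, ?_⟩
    · have := ((tendsto_rpow_neg_atTop (y := 1 / 5) (by norm_num)).comp
        tendsto_natCast_atTop_atTop).const_mul c
      rwa [mul_zero] at this
    · filter_upwards [eventually_gt_atTop 0] with N hN
      obtain ⟨y, hy, -, hay, -⟩ := hroot N hN
      change 0 < a N
      rw [hay]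
      positivity
  have haN : Tendsto (fun N : ℕ => (N : ℝ) * a N) atTop atTop := by
    have := ((tendsto_rpow_atTop (y := 4 / 5) (by norm_num)).comp
        tendsto_natCast_atTop_atTop).const_mul_atTop hc
    refine this.congr' ?_
    filter_upwards [eventually_gt_atTop 0] with N hN
    obtain ⟨y, hy, hNy, hay, h4, -⟩ := hroot N hN
    simp only [Function.comp]
    rw [hay, h4, hNy]
    field_simp
  have hfst := tendsto_fst_probFilter P
  set H : ℕ × Ω → ℝ := fun x => a x.1 * s x with hH_def
  have hH : Tendsto H (probFilter P) (𝓝[>] 0) := by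
    refine tendsto_nhdsWithin_iff.2 ⟨?_, ?_⟩
    · have := ((ha.mono_right nhdsWithin_le_nhds).comp hfst).mul hs
      rwa [zero_mul] at this
    · filter_upwards [hfst.eventually (ha.eventually self_mem_nhdsWithin),
        hs.eventually (lt_mem_nhds one_pos)] with x hx1 hx2
      exact mul_pos hx1 hx2
  set n : ℕ × Ω → ℝ := fun x => x.1 * a x.1 with hn_def
  have hn : ∀ᶠ x in probFilter P, 0 < n x :=
    hfst.eventually (haN.eventually_gt_atTop 0)
  set A : Bool → ∀ x : ℕ × Ω, Fin x.1 → ℝ := fun b x =>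
    armWeight K t (H x) b (designOf W Z x.1 x.2).1 (designOf W Z x.1 x.2).2 with hA_def
  set u : ∀ x : ℕ × Ω, Fin x.1 → ℝ := fun x i => ((W i x.2).1 - t) / H x with hu_def
  have hS : ∀ b j, Tendsto (fun x => (n x)⁻¹ * powerSum (A b x) (u x) j) (probFilter P)
      (𝓝 (armMoment f K t r b j)) := by
    intro b j
    simp only [hA_def, hu_def, powerSum_armWeight]
    exact h.tendsto_armSum_random hD.density_measurable hD.density_nonneg hD.density hft hr
      (hK.isWindow.pow_mul j) b ha haN hs
  have hT : ∀ b j, Tendsto (fun x => (n x)⁻¹ * powerSum (fun i => A b x i ^ 2) (u x) j)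
      (probFilter P) (𝓝 (armSqMoment f K t r b j)) := by
    intro b j
    simp only [hA_def, hu_def, powerSum_armWeight_sq]
    exact h.tendsto_armSum_random hD.density_measurable hD.density_nonneg hD.density hft hr
      (hK.isWindow.sq.pow_mul j) b ha haN hs
  have hA0 : ∀ b x i, 0 ≤ A b x i := fun b x i =>
    mul_nonneg (hK.nonneg _) (armIndicator_nonneg _ _)
  have hu1 : ∀ b x i, A b x i ≠ 0 → |u x i| ≤ 1 := by
    intro b x i hne
    by_contra hlt
    exact hne (mul_eq_zero_of_left (hK.supp _ (not_le.1 hlt)) _)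
  have hbp := tendsto_fit_bias (hS true) hn (hd true) (hA0 true) (hu1 true) hH
    (hD.mean_p.of_le (by norm_num)).isLittleO_sq
  have hbm := tendsto_fit_bias (hS false) hn (hd false) (hA0 false) (hu1 false) hH
    (hD.mean_m.of_le (by norm_num)).isLittleO_sq
  have hvp := tendsto_fit_variance (hS true) (hT true) hn (hd true) (hu1 true) hH hD.var_p_cont
  have hvm := tendsto_fit_variance (hS false) (hT false) hn (hd false) (hu1 false) hH
    hD.var_m_cont
  have hdetp := eventually_fitDet_ne_zero (hS true) (hd true)
  have hdetm := eventually_fitDet_ne_zero (hS false) (hd false)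
  have hmse := eventually_probFilter_of_ae (P := P)
    (p := fun x : ℕ × Ω => ∀ a : ℝ, a ≠ 0 → ∀ w : Bool → Fin x.1 → ℝ,
      (w = fun b => fitWeight (armWeight K t a b (designOf W Z x.1 x.2).1 (designOf W Z x.1 x.2).2)
        (fun i => ((W i x.2).1 - t) / a)) →
      (∀ b, fitDet (armWeight K t a b (designOf W Z x.1 x.2).1 (designOf W Z x.1 x.2).2)
        (fun i => ((W i x.2).1 - t) / a) ≠ 0) →
      condMSE P βhat t (μp t - μm t) W Z a x.1 x.2 =
        (∑ i, w true i * μp (W i x.2).1 - ∑ i, w false i * μm (W i x.2).1 - (μp t - μm t)) ^ 2 +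
          (∑ i, w true i ^ 2 * vp (W i x.2).1 + ∑ i, w false i ^ 2 * vm (W i x.2).1))
    (fun N => h.condMSE_ae_eq hD.cond_p hD.cond_m hβ (μp t - μm t) N)
  -- The scalings are `N ^ (4/5) * H ^ 4 = c ^ 4 * s ^ 4` for the squared bias and `N ^ (4/5) / n =
  -- 1 / c` for the variance.
  have hlim := (((hs.pow 4).const_mul (c ^ 4)).mul ((hbp.sub hbm).pow 2)).add
    ((hvp.add hvm).div_const c)
  rw [one_pow, mul_one] at hlim
  refine hlim.congr' ?_
  filter_upwards [hmse, hdetp, hdetm, hH.eventually self_mem_nhdsWithin,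
    hfst.eventually (eventually_gt_atTop 0)] with x hx1 hx2 hx3 hx4 hx5
  have hx4 : 0 < H x := hx4
  have hXu : ∀ i : Fin x.1, t + H x * u x i = (W i x.2).1 := by
    intro i
    simp only [hu_def]
    field_simp
    ring
  have key := hx1 (H x) hx4.ne' (fun b => fitWeight (A b x) (u x)) rfl
    (fun b => by cases b <;> assumption)
  obtain ⟨y, hy, hNy, hay, h4, -⟩ := hroot x.1 hx5
  have hHy : H x = c * s x / y := by simp only [hH_def, hay]; ring
  have hny : n x = c * y ^ 4 := by simp only [hn_def, hay, hNy]; field_simp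
  have hs0 : s x ≠ 0 := by
    intro h0
    rw [hHy, h0] at hx4
    simp at hx4
  change _ = (x.1 : ℝ) ^ (4 / 5 : ℝ) * condMSE P βhat t (μp t - μm t) W Z (H x) x.1 x.2
  rw [key, h4]
  simp only [hXu]
  rw [hny, hHy]
  field_simp
  ring

end MSE

/-! ### The two designs -/

/-- The local shape of the arm probabilities of the regression discontinuity design. -/
noncomputable def rddShape (b : Bool) (u : ℝ) : ℝ := if (0 < u ↔ b = true) then 1 else 0

lemma hasLocalShape_rdd (t : ℝ) : HasLocalShape (rddProb t) t rddShape where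
  meas b := by
    refine Measurable.ite ?_ measurable_const measurable_const
    have h1 : MeasurableSet {u : ℝ | 0 < u} := measurableSet_Ioi
    cases b
    · convert h1.compl using 1
      ext u
      simp
    · simpa using h1
  nonneg b u := by unfold rddShape; split_ifs <;> norm_num
  le_one b u := by unfold rddShape; split_ifs <;> norm_num
  eq := by
    filter_upwards [self_mem_nhdsWithin] with a ha b u _
    have ha : 0 < a := ha
    by_cases hu : 0 < u <;> cases b <;> simp [armProb, rddProb, rddShape, ha, hu]

/-- As `Δ` is fixed, a small enough bandwidth sees only the randomized zone. -/
lemma hasLocalShape_tbd (t : ℝ) {Δ : ℝ} (hΔ : 0 < Δ) :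
    HasLocalShape (tbdProb t Δ) t (fun _ _ => 1 / 2) where
  meas b := measurable_const
  nonneg b u := by norm_num
  le_one b u := by norm_num
  eq := by
    have hsmall : ∀ᶠ a in 𝓝[>] (0 : ℝ), a < Δ / 2 :=
      mem_nhdsWithin_of_mem_nhds (gt_mem_nhds (by positivity))
    filter_upwards [hsmall, self_mem_nhdsWithin] with a ha ha0 b u hu
    have ha0 : 0 < a := ha0
    have hle : |a * u| ≤ Δ := by
      rw [abs_mul, abs_of_pos ha0]
      nlinarith [abs_nonneg u]
    have hle' := abs_le.1 hle
    have hval : tbdProb t Δ (t + a * u) = 1 / 2 := by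
      unfold tbdProb
      rw [if_neg (by linarith), if_pos (by linarith)]
    cases b
    · simp [armProb, hval]; norm_num
    · simp [armProb, hval]

section Constants

variable {K f : ℝ → ℝ} {t : ℝ}

lemma integral_mul_rddShape {g : ℝ → ℝ} (hs : ∀ u, g (-u) = g u) (b : Bool) (j : ℕ) :
    ∫ u, (u ^ j * g u) * rddShape b u =
      (if b then 1 else (-1) ^ j) * ∫ u in Set.Ioi (0 : ℝ), u ^ j * g u := by
  cases b
  · simp only [Bool.false_eq_true, if_false]
    rw [← integral_Iic_eq_of_symm hs, ← integral_indicator measurableSet_Iic]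
    refine integral_congr_ae (Eventually.of_forall fun u => ?_)
    by_cases hu : 0 < u <;> simp [rddShape, Set.indicator, hu, not_le.2, not_lt.1]
  · simp only [if_true, one_mul]
    rw [← integral_indicator measurableSet_Ioi]
    refine integral_congr_ae (Eventually.of_forall fun u => ?_)
    by_cases hu : 0 < u <;> simp [rddShape, Set.indicator, hu]

lemma armMoment_rdd (hK : IsAdmissibleKernel K) (b : Bool) (j : ℕ) :
    armMoment f K t rddShape b j = f t * ((if b then 1 else (-1) ^ j) * kerHalfMoment K j) := by
  rw [armMoment, integral_mul_rddShape hK.symm, kerHalfMoment]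

lemma armSqMoment_rdd (hK : IsAdmissibleKernel K) (b : Bool) (j : ℕ) :
    armSqMoment f K t rddShape b j =
      f t * ((if b then 1 else (-1) ^ j) * kerHalfSqMoment K j) := by
  rw [armSqMoment, integral_mul_rddShape (g := fun u => K u ^ 2) (fun u => by rw [hK.symm]),
    kerHalfSqMoment]

lemma det_rdd_ne_zero (hK : IsAdmissibleKernel K) (hf : 0 < f t) (b : Bool) :
    armMoment f K t rddShape b 0 * armMoment f K t rddShape b 2 -
      armMoment f K t rddShape b 1 ^ 2 ≠ 0 := by
  have h : armMoment f K t rddShape b 0 * armMoment f K t rddShape b 2 -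
      armMoment f K t rddShape b 1 ^ 2 = f t ^ 2 *
        (kerHalfMoment K 0 * kerHalfMoment K 2 - kerHalfMoment K 1 ^ 2) := by
    simp only [armMoment_rdd hK]
    cases b <;> norm_num <;> ring
  rw [h]
  exact mul_ne_zero (pow_ne_zero 2 hf.ne') hK.half_det_pos.ne'

/-- Every monomial has even total degree in `u`, so the signs `(-1) ^ j` cancel. The arms share one
constant, which is why the bias sees only the difference of curvatures. -/
lemma biasConst_rdd (hK : IsAdmissibleKernel K) (hf : 0 < f t) (b : Bool) :
    biasConst (armMoment f K t rddShape b) =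
      (kerHalfMoment K 2 ^ 2 - kerHalfMoment K 1 * kerHalfMoment K 3) /
        (kerHalfMoment K 0 * kerHalfMoment K 2 - kerHalfMoment K 1 ^ 2) := by
  have h2 : f t ^ 2 ≠ 0 := pow_ne_zero 2 hf.ne'
  rw [biasConst]
  refine Eq.trans ?_ (mul_div_mul_left _ _ h2)
  simp only [armMoment_rdd hK]
  congr 1 <;> cases b <;> norm_num <;> ring

lemma varConst_rdd (hK : IsAdmissibleKernel K) (hf : 0 < f t) (b : Bool) :
    varConst (armMoment f K t rddShape b) (armSqMoment f K t rddShape b) = rddC2 K / f t := by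
  have h3 : f t ^ 3 ≠ 0 := pow_ne_zero 3 hf.ne'
  rw [varConst, rddC2, div_div]
  refine Eq.trans ?_ (mul_div_mul_left _ _ h3)
  simp only [armMoment_rdd hK, armSqMoment_rdd hK]
  congr 1 <;> cases b <;> norm_num <;> ring

lemma armMoment_tbd (b : Bool) (j : ℕ) :
    armMoment f K t (fun _ _ => 1 / 2) b j = f t * (kerMoment K j / 2) := by
  rw [armMoment, integral_mul_const, kerMoment]
  ring

lemma armSqMoment_tbd (b : Bool) (j : ℕ) :
    armSqMoment f K t (fun _ _ => 1 / 2) b j = f t * (kerSqMoment K j / 2) := by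
  rw [armSqMoment, integral_mul_const, kerSqMoment]
  ring

lemma det_tbd_ne_zero (hK : IsAdmissibleKernel K) (hf : 0 < f t) (b : Bool) :
    armMoment f K t (fun _ _ => 1 / 2) b 0 * armMoment f K t (fun _ _ => 1 / 2) b 2 -
      armMoment f K t (fun _ _ => 1 / 2) b 1 ^ 2 ≠ 0 := by
  simp only [armMoment_tbd, hK.kerMoment_eq]
  have h0 := hK.halfMoment_pos 0
  have h2 := hK.halfMoment_pos 2
  norm_num
  exact ⟨⟨hf.ne', h0.ne'⟩, hf.ne', h2.ne'⟩

lemma biasConst_tbd (hf : 0 < f t) (b : Bool) :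
    biasConst (armMoment f K t (fun _ _ => 1 / 2) b) =
      (kerMoment K 2 ^ 2 - kerMoment K 1 * kerMoment K 3) /
        (kerMoment K 0 * kerMoment K 2 - kerMoment K 1 ^ 2) := by
  have h2 : f t ^ 2 / 4 ≠ 0 := div_ne_zero (pow_ne_zero 2 hf.ne') (by norm_num)
  rw [biasConst]
  refine Eq.trans ?_ (mul_div_mul_left _ _ h2)
  simp only [armMoment_tbd]
  congr 1 <;> ring

/-- Each arm receives half of the subjects near `t`; the resulting doubling of the variance is the
factor `2` in `tbdC2`. -/
lemma varConst_tbd (hf : 0 < f t) (b : Bool) :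
    varConst (armMoment f K t (fun _ _ => 1 / 2) b) (armSqMoment f K t (fun _ _ => 1 / 2) b) =
      tbdC2 K / f t := by
  have h3 : f t ^ 3 / 16 ≠ 0 := div_ne_zero (pow_ne_zero 3 hf.ne') (by norm_num)
  rw [varConst, tbdC2, div_div]
  refine Eq.trans ?_ (mul_div_mul_left _ _ h3)
  simp only [armMoment_tbd, armSqMoment_tbd]
  congr 1 <;> ring

end Constants

/-! ### The optimal bandwidths -/

section Optimal

variable {f μp μm vp vm : ℝ → ℝ} {t : ℝ} {D : Measure (ℝ × ℝ × ℝ)} [IsProbabilityMeasure D]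

lemma RegularAt.gammaConst_pos (hD : RegularAt D t f μp μm vp vm) :
    0 < gammaConst t f μp μm vp vm := by
  have h1 := hD.density_pos
  have h2 := hD.var_p_pos
  have h3 := hD.var_m_pos
  have h4 : iteratedDeriv 2 μp t - iteratedDeriv 2 μm t ≠ 0 := sub_ne_zero.2 hD.curvature_ne
  unfold gammaConst
  positivity

lemma RegularAt.gammaConst_pow_five (hD : RegularAt D t f μp μm vp vm) :
    gammaConst t f μp μm vp vm ^ 5 =
      (vp t + vm t) / (f t * (iteratedDeriv 2 μp t - iteratedDeriv 2 μm t) ^ 2) := by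
  have h1 := hD.density_pos
  have h2 := hD.var_p_pos
  have h3 := hD.var_m_pos
  unfold gammaConst
  rw [← Real.rpow_natCast, ← Real.rpow_mul (by positivity)]
  norm_num

lemma rpow_one_fifth_pow_five {x : ℝ} (hx : 0 ≤ x) : (x ^ (1 / 5 : ℝ)) ^ 5 = x := by
  rw [← Real.rpow_natCast, ← Real.rpow_mul hx]
  norm_num

/-- The asymptotic mean squared error at the optimal bandwidth. -/
lemma RegularAt.optimal_mse (hD : RegularAt D t f μp μm vp vm) {C₁ C₂ β : ℝ} (hC₁ : 0 < C₁)
    (hC₂ : 0 < C₂) (hβ : C₁ = 1 / 4 * β ^ 2) :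
    ((C₂ / (4 * C₁)) ^ (1 / 5 : ℝ) * gammaConst t f μp μm vp vm) ^ 4 *
        (iteratedDeriv 2 μp t / 2 * β - iteratedDeriv 2 μm t / 2 * β) ^ 2 +
      (vp t * (C₂ / f t) + vm t * (C₂ / f t)) /
        ((C₂ / (4 * C₁)) ^ (1 / 5 : ℝ) * gammaConst t f μp μm vp vm) =
      (5 * gammaConst t f μp μm vp vm ^ 4 *
        (iteratedDeriv 2 μp t - iteratedDeriv 2 μm t) ^ 2) *
        (C₁ * ((C₂ / (4 * C₁)) ^ (1 / 5 : ℝ)) ^ 4) := by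
  have hq5 := rpow_one_fifth_pow_five (x := C₂ / (4 * C₁)) (by positivity)
  have hq : 0 < (C₂ / (4 * C₁)) ^ (1 / 5 : ℝ) := by positivity
  have hg := hD.gammaConst_pos
  have hg5 := hD.gammaConst_pow_five
  have hf := hD.density_pos
  have hne : iteratedDeriv 2 μp t - iteratedDeriv 2 μm t ≠ 0 := sub_ne_zero.2 hD.curvature_ne
  set q := (C₂ / (4 * C₁)) ^ (1 / 5 : ℝ)
  set γ := gammaConst t f μp μm vp vm
  set d₁ := iteratedDeriv 2 μp t
  set d₂ := iteratedDeriv 2 μm t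
  have hC : C₂ = 4 * C₁ * q ^ 5 := by rw [hq5]; field_simp
  have hV : vp t + vm t = γ ^ 5 * (f t * (d₁ - d₂) ^ 2) := by rw [hg5]; field_simp
  have e1 : (d₁ / 2 * β - d₂ / 2 * β) ^ 2 = C₁ * (d₁ - d₂) ^ 2 := by rw [hβ]; ring
  -- Optimality of the bandwidth: the variance is four times the squared bias, whence the factor
  -- `5`.
  have e2 : (vp t * (C₂ / f t) + vm t * (C₂ / f t)) / (q * γ) =
      4 * C₁ * q ^ 4 * γ ^ 4 * (d₁ - d₂) ^ 2 := by
    rw [← add_mul, hV, hC]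
    field_simp
  rw [e1, e2]
  ring

/-- The fifth power of `C₁ * q ^ 4` with `q ^ 5 = C₂ / (4 * C₁)` is `C₁ * C₂ ^ 4 / 4 ^ 4`, and the
powers of `4` cancel in the quotient. -/
lemma IsAdmissibleKernel.kerRatio_rpow {K : ℝ → ℝ} (hK : IsAdmissibleKernel K) :
    kerRatio K ^ (1 / 5 : ℝ) =
      (rddC1 K * ((rddC2 K / (4 * rddC1 K)) ^ (1 / 5 : ℝ)) ^ 4) /
        (tbdC1 K * ((tbdC2 K / (4 * tbdC1 K)) ^ (1 / 5 : ℝ)) ^ 4) := by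
  have h1 := hK.rddC1_pos
  have h2 := hK.rddC2_pos
  have h3 := hK.tbdC1_pos
  have h4 := hK.tbdC2_pos
  have h5 := hK.kerRatio_pos
  rw [← pow_left_inj₀ (by positivity) (by positivity) (n := 5) (by norm_num),
    rpow_one_fifth_pow_five h5.le, div_pow, mul_pow, mul_pow, pow_right_comm _ 4 5,
    rpow_one_fifth_pow_five (by positivity), pow_right_comm _ 4 5,
    rpow_one_fifth_pow_five (by positivity), kerRatio]
  field_simp

end Optimal

/-! ### The main theorem -/

section Main

variable {Ω : Type*} [MeasurableSpace Ω] {P : Measure Ω} [IsProbabilityMeasure P]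
  {D : Measure (ℝ × ℝ × ℝ)} [IsProbabilityMeasure D] {t : ℝ} {f μp μm vp vm K : ℝ → ℝ}
  {W : ℕ → Ω → ℝ × ℝ × ℝ}

/-- The general limit, with the true `γ` absorbed in `c` and the relative error of its estimate in
`s`. -/
lemma tendsto_condMSE_rdd (hD : RegularAt D t f μp μm vp vm) (hK : IsAdmissibleKernel K)
    {βhat : FitRule} (hβ : IsLocalLinearFit K t βhat) (hW : IsIIDSample P D W)
    {γ : ℕ → Ω → ℝ}
    (hγ : TendstoInMeasure P γ atTop (fun _ => gammaConst t f μp μm vp vm)) :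
    Tendsto (fun x : ℕ × Ω => (x.1 : ℝ) ^ (4 / 5 : ℝ) *
        condMSE P βhat t (μp t - μm t) W (fun i ω => rddTreatment t (W i ω).1)
          (rddBandwidth K (γ x.1 x.2) x.1) x.1 x.2)
      (probFilter P)
      (𝓝 ((5 * gammaConst t f μp μm vp vm ^ 4 *
        (iteratedDeriv 2 μp t - iteratedDeriv 2 μm t) ^ 2) *
        (rddC1 K * ((rddC2 K / (4 * rddC1 K)) ^ (1 / 5 : ℝ)) ^ 4))) := by
  have hg := hD.gammaConst_pos
  have h1 := hK.rddC1_pos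
  have h2 := hK.rddC2_pos
  have hs : Tendsto (fun x : ℕ × Ω => γ x.1 x.2 / gammaConst t f μp μm vp vm)
      (probFilter P) (𝓝 1) := by
    have := (tendstoInMeasure_const_iff.1 hγ).div_const (gammaConst t f μp μm vp vm)
    rwa [div_self hg.ne'] at this
  have := (hW.isDesign_rdd t).tendsto_condMSE hD (hasLocalShape_rdd t) hK hβ
    (det_rdd_ne_zero hK hD.density_pos)
    (c := (rddC2 K / (4 * rddC1 K)) ^ (1 / 5 : ℝ) * gammaConst t f μp μm vp vm)
    (by positivity) hs
  rw [biasConst_rdd hK hD.density_pos, biasConst_rdd hK hD.density_pos,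
    varConst_rdd hK hD.density_pos, varConst_rdd hK hD.density_pos,
    hD.optimal_mse h1 h2 rfl] at this
  refine this.congr fun x => ?_
  congr 2
  rw [rddBandwidth]
  field_simp

lemma tendsto_condMSE_tbd (hD : RegularAt D t f μp μm vp vm) (hK : IsAdmissibleKernel K)
    {βhat : FitRule} (hβ : IsLocalLinearFit K t βhat) {Δ : ℝ} (hΔ : 0 < Δ) {Z : ℕ → Ω → ℝ}
    (hW : IsTBDSample P D t Δ W Z) {γ : ℕ → Ω → ℝ}
    (hγ : TendstoInMeasure P γ atTop (fun _ => gammaConst t f μp μm vp vm)) :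
    Tendsto (fun x : ℕ × Ω => (x.1 : ℝ) ^ (4 / 5 : ℝ) *
        condMSE P βhat t (μp t - μm t) W Z (tbdBandwidth K (γ x.1 x.2) x.1) x.1 x.2)
      (probFilter P)
      (𝓝 ((5 * gammaConst t f μp μm vp vm ^ 4 *
        (iteratedDeriv 2 μp t - iteratedDeriv 2 μm t) ^ 2) *
        (tbdC1 K * ((tbdC2 K / (4 * tbdC1 K)) ^ (1 / 5 : ℝ)) ^ 4))) := by
  have hg := hD.gammaConst_pos
  have h1 := hK.tbdC1_pos
  have h2 := hK.tbdC2_pos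
  have hs : Tendsto (fun x : ℕ × Ω => γ x.1 x.2 / gammaConst t f μp μm vp vm)
      (probFilter P) (𝓝 1) := by
    have := (tendstoInMeasure_const_iff.1 hγ).div_const (gammaConst t f μp μm vp vm)
    rwa [div_self hg.ne'] at this
  have := hW.isDesign.tendsto_condMSE hD (hasLocalShape_tbd t hΔ) hK hβ
    (det_tbd_ne_zero hK hD.density_pos)
    (c := (tbdC2 K / (4 * tbdC1 K)) ^ (1 / 5 : ℝ) * gammaConst t f μp μm vp vm)
    (by positivity) hs
  rw [biasConst_tbd hD.density_pos, biasConst_tbd hD.density_pos,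
    varConst_tbd hD.density_pos, varConst_tbd hD.density_pos,
    hD.optimal_mse h1 h2 rfl] at this
  refine this.congr fun x => ?_
  congr 2
  rw [tbdBandwidth]
  field_simp

end Main

theorem theorem1 {Ω : Type*} [MeasurableSpace Ω] (P : Measure Ω) [IsProbabilityMeasure P]
    -- the population, the threshold and the kernel
    (D : Measure (ℝ × ℝ × ℝ)) [IsProbabilityMeasure D] (t : ℝ)
    (f μp μm vp vm : ℝ → ℝ) (hD : RegularAt D t f μp μm vp vm)
    (K : ℝ → ℝ) (hK : IsAdmissibleKernel K)
    (βhat : FitRule) (hβ : IsLocalLinearFit K t βhat)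
    -- the subjects of the regression discontinuity design
    (W : ℕ → Ω → ℝ × ℝ × ℝ) (hW : IsIIDSample P D W)
    -- the subjects and the treatments of the tie-breaker design
    (Δ : ℝ) (hΔ : 0 < Δ) (W' : ℕ → Ω → ℝ × ℝ × ℝ) (Z' : ℕ → Ω → ℝ)
    (hW' : IsTBDSample P D t Δ W' Z')
    -- consistent estimators of `γ` in the two designs
    (γR γT : ℕ → Ω → ℝ)
    (hγR : TendstoInMeasure P γR atTop (fun _ => gammaConst t f μp μm vp vm))
    (hγT : TendstoInMeasure P γT atTop (fun _ => gammaConst t f μp μm vp vm))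
    -- the sample size `M N ≈ θ N` of the tie-breaker design
    (θ : ℝ) (hθ : 0 < θ) (M : ℕ → ℕ)
    (hM : Tendsto (fun N => (M N : ℝ) / (N : ℝ)) atTop (𝓝 θ)) :
    TendstoInMeasure P
      (fun N ω =>
        condMSE P βhat t (μp t - μm t) W (fun i ω => rddTreatment t (W i ω).1)
            (rddBandwidth K (γR N ω) N) N ω /
          condMSE P βhat t (μp t - μm t) W' Z'
            (tbdBandwidth K (γT (M N) ω) (M N)) (M N) ω)
      atTop (fun _ => θ ^ (4 / 5 : ℝ) * kerRatio K ^ (1 / 5 : ℝ)) ∧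
    (θ ^ (4 / 5 : ℝ) * kerRatio K ^ (1 / 5 : ℝ) = 1 ↔ θ = thetaStar K) ∧
    (IsAdmissibleKernel triangularKernel ∧
      kerRatio triangularKernel = 60.466176 ∧
      |kerRatio triangularKernel ^ (1 / 5 : ℝ) - 2.27| < 0.005 ∧
      |thetaStar triangularKernel - 0.359| < 0.0005 ∧
      |thetaStar triangularKernel - 0.36| < 0.005) := by
  refine ⟨?_, hK.limit_eq_one_iff hθ, isAdmissibleKernel_triangularKernel,
    kerRatio_triangularKernel, abs_kerRatio_triangularKernel_rpow_sub_lt, ?_, ?_⟩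
  · have hR := tendsto_condMSE_rdd hD hK hβ hW hγR
    have hMtop : Tendsto M atTop atTop := by
      have h1 : Tendsto (fun N : ℕ => (M N : ℝ) / N * N) atTop atTop :=
        hM.pos_mul_atTop hθ tendsto_natCast_atTop_atTop
      refine tendsto_natCast_atTop_iff.1 (h1.congr' ?_)
      filter_upwards [eventually_gt_atTop 0] with N hN
      have : (N : ℝ) ≠ 0 := Nat.cast_ne_zero.2 hN.ne'
      field_simp
    have hT := (tendsto_condMSE_tbd hD hK hβ hΔ hW' hγT).comp (tendsto_map_probFilter P hMtop)
    have hMN : Tendsto (fun x : ℕ × Ω => ((M x.1 : ℝ) / x.1) ^ (4 / 5 : ℝ)) (probFilter P)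
        (𝓝 (θ ^ (4 / 5 : ℝ))) :=
      (hM.rpow_const (Or.inl hθ.ne')).comp (tendsto_fst_probFilter P)
    have h1 := hK.tbdC1_pos
    have h2 := hK.tbdC2_pos
    have hg := hD.gammaConst_pos
    have hd : iteratedDeriv 2 μp t - iteratedDeriv 2 μm t ≠ 0 := sub_ne_zero.2 hD.curvature_ne
    -- The errors are normalized by `N ^ (4/5)` and `(M N) ^ (4/5)`; the factor `hMN` corrects for
    -- this and yields `θ ^ (4/5)`.
    have hlim := hMN.mul (hR.div hT (by positivity))
    rw [mul_div_mul_left _ _ (by positivity), ← hK.kerRatio_rpow] at hlim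
    rw [tendstoInMeasure_const_iff]
    refine hlim.congr' ?_
    filter_upwards [(tendsto_fst_probFilter P).eventually (eventually_gt_atTop 0),
      (tendsto_fst_probFilter P).eventually (hMtop.eventually_gt_atTop 0)] with x hx1 hx2
    have hx1' : (0 : ℝ) < x.1 := Nat.cast_pos.2 hx1
    have hx2' : (0 : ℝ) < M x.1 := Nat.cast_pos.2 hx2
    have e1 : (x.1 : ℝ) ^ (4 / 5 : ℝ) ≠ 0 := by positivity
    have e2 : (M x.1 : ℝ) ^ (4 / 5 : ℝ) ≠ 0 := by positivity
    simp only [Pi.div_apply, Function.comp]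
    rw [Real.div_rpow hx2'.le hx1'.le, div_mul_div_comm, mul_left_comm, ← mul_assoc,
      ← mul_assoc]
    rw [mul_div_mul_left _ _ (mul_ne_zero e1 e2)]
  · have := thetaStar_triangularKernel_bounds
    rw [abs_sub_lt_iff]
    constructor <;> linarith [this.1, this.2]
  · have := thetaStar_triangularKernel_bounds
    rw [abs_sub_lt_iff]
    constructor <;> linarith [this.1, this.2]
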